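/- Let $T>0$ and $0<\lambda_{\min}<\lambda_{\max}<\infty$. Then there are constants $C,c>0$, depending only on $T,\lambda_{\min},\lambda_{\max}$, such that the following holds. Let $H(t,u)$, $t\ge u$, be a (measurable) real function with $H(u,u)=1$, $H(t+T,u+T)=H(t,u)$, and $t\mapsto H(t,u)\in C^1([u,\infty))$ for every $u$. Put $K(t,u):=-\frac{\mathrm d}{\mathrm dt}H(t,u)$ and $\lambda(t,u):=K(t,u)/H(t,u)$, and assume that $\lambda_{\min}\le\lambda(t,u)\le\lambda_{\max}$ for all $t\ge u$. Then there is a unique $T$-periodic function $\rho:\mathbb R\to\mathbb R$, integrable over a period, with \[ \rho(t)=\int_{-\infty}^t K(t,u)\rho(u)\,\mathrm du,\qquad 1=\int_{-\infty}^t H(t,u)\rho(u)\,\mathrm du\qquad\text{for all }t\in\mathbb R, \] and for every $t\in\mathbb R$ the measure $\nu^t_\infty(\mathrm du):=\rho(t-u)\,H(t,t-u)\,\mathrm du$ on $[0,\infty)$ is a probability measure. Moreover, let $s\in\mathbb R$ and let $s=T_0<T_1<T_2<\cdots$ be a sequence of random variables on a probability space with $\mathbb P(T_{k+1}>t\mid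 T_k)=H(t,T_k)$ for all $k\ge0$ and $t\in\mathbb R$ (where $H(t,u):=1$ for $t<u$). For $t\ge s$ put $N^s_t:=\sup\{k\ge0:T_k\le t\}$, which is almost surely finite, and $Y^s_t:=t-T_{N^s_t}$. Then for all $t\ge s$: 1. $d_{TV}(\mathcal L(Y^s_t),\nu^t_\infty)\le C e^{-c(t-s)}$, where $d_{TV}(\mu,\nu):=\sup_A|\mu(A)-\nu(A)|$ is the total variation distance; 2. the limit $r(t,s):=\lim_{h\downarrow0}\frac1h\,\mathbb P(N^s_{t+h}-N^s_t>0)$ exists and $|r(t,s)-\rho(t)|\le C\lambda_{\max}e^{-c(t-s)}$; 3. for all $a>0$, $N^s_{t+a}-N^s_t$ is integrable and \[ \left|\mathbb E(N^s_{t+a}-N^s_t)-\int_t^{t+a}\rho(u)\,\mathrm du\right|\le\frac{C\lambda_{\max}}{c}\,e^{-c(t-s)}. \] -/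

import Mathlib

open MeasureTheory Set Filter Topology

noncomputable section

namespace PeriodicRenewal

/-- The density `K(t,u) = -∂ₜ H(t,u)` on `[u,∞)` (one-sided derivative at `t = u`). -/
def density (H : ℝ → ℝ → ℝ) (t u : ℝ) : ℝ :=
  -derivWithin (fun x => H x u) (Ici u) t

/-- The hazard rate `λ(t,u) = K(t,u) / H(t,u)`. -/
def hazard (H : ℝ → ℝ → ℝ) (t u : ℝ) : ℝ :=
  density H t u / H t u

/-- The probability that the event following an event at time `u` occurs after time `t`. Only the
values `H t u` with `u ≤ t` are meaningful; for `t < u` this probability is `1`. -/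
def survival (H : ℝ → ℝ → ℝ) (t u : ℝ) : ℝ :=
  if u ≤ t then H t u else 1

/-- The standing assumptions on the kernel `H`. All of them concern only the values `H t u` with
`u ≤ t`. -/
structure IsKernel (T lmin lmax : ℝ) (H : ℝ → ℝ → ℝ) : Prop where
  measurable : Measurable (fun p : ℝ × ℝ => survival H p.1 p.2)
  diag : ∀ u, H u u = 1
  periodic : ∀ t u, u ≤ t → H (t + T) (u + T) = H t u
  contDiffOn : ∀ u, ContDiffOn ℝ 1 (fun t => H t u) (Ici u)
  hazard_ge : ∀ t u, u ≤ t → lmin ≤ hazard H t u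
  hazard_le : ∀ t u, u ≤ t → hazard H t u ≤ lmax

/-- `ρ` is a function in `L¹(ℝ/Tℤ)` (seen as a `T`-periodic function on `ℝ`) that solves the two
integral equations for every real `t`. -/
structure IsProfile (T : ℝ) (H : ℝ → ℝ → ℝ) (ρ : ℝ → ℝ) : Prop where
  periodic : Function.Periodic ρ T
  integrableOn : IntegrableOn ρ (Ioc 0 T)
  eq_integral : ∀ t, ρ t = ∫ u in Iic t, density H t u * ρ u
  normalized : ∀ t, ∫ u in Iic t, H t u * ρ u = 1

/-- The measure on `ℝ₊` (seen as a measure on `ℝ`) with density `u ↦ ρ(t-u) H(t,t-u)`. -/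
def nuInf (H : ℝ → ℝ → ℝ) (ρ : ℝ → ℝ) (t : ℝ) : Measure ℝ :=
  (volume.restrict (Ici 0)).withDensity (fun u => ENNReal.ofReal (ρ (t - u) * H t (t - u)))

/-- `τ 0 < τ 1 < ⋯` are the random times of a renewal process with kernel `H` started at time `s`:
`τ 0 = s` and `ℙ(τ (k+1) > t | τ k) = H(t, τ k)`. -/
structure IsArrivalSequence {Ω : Type*} [MeasurableSpace Ω] (H : ℝ → ℝ → ℝ) (s : ℝ)
    (P : Measure Ω) (τ : ℕ → Ω → ℝ) : Prop where
  measurable : ∀ k, Measurable (τ k)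
  start : ∀ᵐ ω ∂P, τ 0 ω = s
  increasing : ∀ᵐ ω ∂P, StrictMono (fun k => τ k ω)
  condLaw : ∀ (k : ℕ) (t : ℝ),
    P[{ω | t < τ (k + 1) ω}.indicator (fun _ => (1 : ℝ)) |
        MeasurableSpace.comap (τ k) inferInstance]
      =ᵐ[P] fun ω => survival H t (τ k ω)

/-- The number of events up to time `t`, `sup {k ≥ 0 : τ k ≤ t}`. -/
def count {Ω : Type*} (τ : ℕ → Ω → ℝ) (t : ℝ) (ω : Ω) : ℕ :=
  sSup {k : ℕ | τ k ω ≤ t}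

/-- The backward recurrence time `t - τ (N t)`. -/
def age {Ω : Type*} (τ : ℕ → Ω → ℝ) (t : ℝ) (ω : Ω) : ℝ :=
  t - τ (count τ t ω) ω

/-- The total variation distance `sup_A |μ(A) - ν(A)|` of two probability measures. -/
def tvDist (μ ν : Measure ℝ) : ℝ :=
  ⨆ A : {A : Set ℝ // MeasurableSet A}, |μ.real A.1 - ν.real A.1|

end PeriodicRenewal

end

/-! The hazard rate is at least `lmin`, so the waiting time density splits as `K = lmin * H + E`
with excess `E ≥ 0`. Wherever the total `H`-mass is one, an equation with kernel `K` becomes an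
equation with source `lmin` and kernel `E`. For the profile this reads `ρ = lmin + ∫ E ρ`, and its
minimal solution is the monotone limit of iterates started at zero.

Integrating the variation-of-constants identity `exp(-lmin (t-u)) = H(t,u) + ∫ exp(-lmin (t-x))
E(x,u) dx` against the iterates shows that their `H`-mass is at most one. Since `E ≤ (lmax - lmin)
H`, the iterates stay below `lmax`. The same identity applied to the limit gives mass exactly one,
and adding `lmin * H` back to `E` recovers `ρ = ∫ K ρ`.

The solution `ρ`, which takes values in `[lmin, lmax]`, also serves as the weight for every
estimate: `∫ E ρ = ρ - lmin ≤ (1 - lmin/lmax) ρ`, so `E` is a strict contraction relative to `ρ`.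
Half of this margin pays for an additional weight `exp(c (t-u))` with small `c`
(`lintegral_exp_rate_mul_excessKernel_le`). The comparison lemma `le_mul_of_contraction` then gives
uniqueness, and convergence at rate `c`.

On the probabilistic side, the expected number of arrivals is the measure `δ_s + R(u) du`. Because a
last arrival before `t` almost surely exists, its `H`-mass is one for `t ≥ s`, so `R = lmin + E(·,
s) + ∫ E R`. The equations for `R` and `ρ` differ only by terms of size `lmax * exp(-lmin (t-s))`,
and the weighted contraction yields `|R - ρ| ≤ A exp(-c (t-s)) ρ` (`gap_le`). The three estimates
follow by integrating this bound against `H`, by evaluating it at `t`, and by integrating it over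
`(t, ∞)`. -/

namespace PeriodicRenewal

open scoped ENNReal

variable {T lmin lmax : ℝ} {H : ℝ → ℝ → ℝ} {s t u : ℝ}

/-! ### Pointwise bounds on the kernel -/

namespace IsKernel

/-- A nonpositive value would force a zero of `H` by continuity from `H u u = 1`. There the hazard
is a quotient by zero, hence `0` by convention, against the lower bound `lmin`. -/
theorem pos (hk : IsKernel T lmin lmax H) (hmin : 0 < lmin) (h : u ≤ t) : 0 < H t u := by
  by_contra! hneg
  have hc : ContinuousOn (fun x => H x u) (Icc u t) :=
    (hk.contDiffOn u).continuousOn.mono Icc_subset_Ici_self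
  obtain ⟨x, hx, hx0⟩ := intermediate_value_Icc' h hc ⟨hneg, by simp [hk.diag]⟩
  have hx1 := hk.hazard_ge x u hx.1
  simp only [hazard] at hx1
  simp only at hx0
  rw [hx0, div_zero] at hx1
  linarith

theorem le_density (hk : IsKernel T lmin lmax H) (hmin : 0 < lmin) (h : u ≤ t) :
    lmin * H t u ≤ density H t u := by
  have := hk.hazard_ge t u h
  rwa [hazard, le_div_iff₀ (hk.pos hmin h)] at this

theorem density_le (hk : IsKernel T lmin lmax H) (hmin : 0 < lmin) (h : u ≤ t) :
    density H t u ≤ lmax * H t u := by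
  have := hk.hazard_le t u h
  rwa [hazard, div_le_iff₀ (hk.pos hmin h)] at this

theorem density_nonneg (hk : IsKernel T lmin lmax H) (hmin : 0 < lmin) (h : u ≤ t) :
    0 ≤ density H t u :=
  (mul_nonneg hmin.le (hk.pos hmin h).le).trans (hk.le_density hmin h)

theorem continuousOn_density (hk : IsKernel T lmin lmax H) (u : ℝ) :
    ContinuousOn (fun x => density H x u) (Ici u) :=
  ((hk.contDiffOn u).continuousOn_derivWithin (uniqueDiffOn_Ici u) le_rfl).neg

theorem hasDerivWithinAt (hk : IsKernel T lmin lmax H) (h : u ≤ t) :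
    HasDerivWithinAt (fun x => H x u) (-density H t u) (Ici u) t := by
  rw [density, neg_neg]
  exact ((hk.contDiffOn u).differentiableOn one_ne_zero t h).hasDerivWithinAt

theorem continuousOn_exp_mul (hk : IsKernel T lmin lmax H) (a t u : ℝ) :
    ContinuousOn (fun x => Real.exp (-a * (t - x)) * (density H x u - a * H x u)) (Ici u) :=
  (Continuous.continuousOn (by fun_prop)).mul ((hk.continuousOn_density u).sub
    (continuousOn_const.mul (hk.contDiffOn u).continuousOn))

/-- Variation of constants: `∂ₜ H = -a H - (K - a H)`. -/
theorem integral_exp_mul (hk : IsKernel T lmin lmax H) (a : ℝ) (hus : u ≤ s) (hst : s ≤ t) :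
    ∫ x in s..t, Real.exp (-a * (t - x)) * (density H x u - a * H x u)
      = Real.exp (-a * (t - s)) * H s u - H t u := by
  have hsub : Icc s t ⊆ Ici u := fun x hx => hus.trans hx.1
  have hd : ∀ x ∈ Ioo s t, HasDerivAt (fun x => -(Real.exp (-a * (t - x)) * H x u))
      (Real.exp (-a * (t - x)) * (density H x u - a * H x u)) x := by
    intro x hx
    have h1 : HasDerivAt (fun x => H x u) (-density H x u) x :=
      (hk.hasDerivWithinAt (hus.trans hx.1.le)).hasDerivAt (Ici_mem_nhds (hus.trans_lt hx.1))
    have h2 : HasDerivAt (fun x => Real.exp (-a * (t - x))) (Real.exp (-a * (t - x)) * a) x := by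
      have : HasDerivAt (fun x : ℝ => -a * (t - x)) a x := by
        simpa using ((hasDerivAt_id x).const_sub t).const_mul (-a)
      exact this.exp
    refine (h2.mul h1).neg.congr_deriv ?_
    ring
  have hc : ContinuousOn (fun x => -(Real.exp (-a * (t - x)) * H x u)) (Icc s t) :=
    ((Continuous.continuousOn (by fun_prop)).mul
      ((hk.contDiffOn u).continuousOn.mono hsub)).neg
  have hi : IntervalIntegrable
      (fun x => Real.exp (-a * (t - x)) * (density H x u - a * H x u)) volume s t :=
    ((hk.continuousOn_exp_mul a t u).mono (by rwa [uIcc_of_le hst])).intervalIntegrable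
  rw [intervalIntegral.integral_eq_sub_of_hasDerivAt_of_le hst hc hd hi]
  simp
  ring

theorem le_exp_mul (hk : IsKernel T lmin lmax H) (hmin : 0 < lmin) (hus : u ≤ s) (hst : s ≤ t) :
    H t u ≤ Real.exp (-lmin * (t - s)) * H s u := by
  have h := hk.integral_exp_mul lmin hus hst
  have h0 : 0 ≤ ∫ x in s..t, Real.exp (-lmin * (t - x)) * (density H x u - lmin * H x u) := by
    refine intervalIntegral.integral_nonneg hst fun x hx => ?_
    have := hk.le_density hmin (hus.trans hx.1)
    exact mul_nonneg (Real.exp_pos _).le (by linarith)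
  linarith

theorem le_exp (hk : IsKernel T lmin lmax H) (hmin : 0 < lmin) (hut : u ≤ t) :
    H t u ≤ Real.exp (-lmin * (t - u)) := by
  simpa [hk.diag] using hk.le_exp_mul hmin le_rfl hut

theorem le_one (hk : IsKernel T lmin lmax H) (hmin : 0 < lmin) (hut : u ≤ t) : H t u ≤ 1 :=
  (hk.le_exp hmin hut).trans (Real.exp_le_one_iff.2 (by nlinarith))

theorem antitone (hk : IsKernel T lmin lmax H) (hmin : 0 < lmin) (hus : u ≤ s) (hst : s ≤ t) :
    H t u ≤ H s u := by
  refine (hk.le_exp_mul hmin hus hst).trans (mul_le_of_le_one_left (hk.pos hmin hus).le ?_)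
  exact Real.exp_le_one_iff.2 (by nlinarith)

theorem sub_le (hk : IsKernel T lmin lmax H) (hmin : 0 < lmin) (hmax : lmin < lmax)
    (hus : u ≤ s) (hst : s ≤ t) : H s u - H t u ≤ lmax * (t - s) := by
  -- With `a = 0`, variation of constants is the fundamental theorem of calculus for `H`.
  have h := hk.integral_exp_mul 0 hus hst
  simp only [neg_zero, zero_mul, Real.exp_zero, one_mul, sub_zero] at h
  rw [← h]
  have hb : ∀ x ∈ uIoc s t, ‖density H x u‖ ≤ lmax := by
    intro x hx
    rw [uIoc_of_le hst] at hx
    have hux := hus.trans hx.1.le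
    rw [Real.norm_of_nonneg (hk.density_nonneg hmin hux)]
    refine (hk.density_le hmin hux).trans (mul_le_of_le_one_right (hmin.trans hmax).le ?_)
    exact hk.le_one hmin hux
  have := intervalIntegral.norm_integral_le_of_norm_le_const hb
  rw [abs_of_nonneg (by linarith)] at this
  exact (le_abs_self _).trans this

theorem density_periodic (hk : IsKernel T lmin lmax H) (h : u ≤ t) :
    density H (t + T) (u + T) = density H t u := by
  have h1 : HasDerivWithinAt (fun x => H (x + T) (u + T)) (-density H (t + T) (u + T)) (Ici u) t := by
    have h2 := hk.hasDerivWithinAt (add_le_add_left h T)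
    have h3 : HasDerivWithinAt (fun x : ℝ => x + T) 1 (Ici u) t :=
      (hasDerivWithinAt_id t _).add_const T
    simpa [Function.comp_def] using
      h2.scomp t h3 (fun x (hx : u ≤ x) => add_le_add_left hx T)
  have h4 := h1.congr (f₁ := fun x => H x u) (fun x hx => (hk.periodic x u hx).symm)
    (hk.periodic t u h).symm
  have := (uniqueDiffOn_Ici u t h).eq_deriv _ h4 (hk.hasDerivWithinAt h)
  linarith

end IsKernel

/-! ### Kernels extended by zero, with values in `[0, ∞]` -/

/-- The survival function, set to zero before the starting time. -/
noncomputable def survKernel (H : ℝ → ℝ → ℝ) (t u : ℝ) : ℝ≥0∞ :=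
  if u ≤ t then ENNReal.ofReal (H t u) else 0

/-- The waiting time density, set to zero before the starting time. -/
noncomputable def arrivalKernel (H : ℝ → ℝ → ℝ) (t u : ℝ) : ℝ≥0∞ :=
  if u ≤ t then ENNReal.ofReal (density H t u) else 0

/-- The part of the waiting time density in excess of the constant hazard rate `a`. -/
noncomputable def excessKernel (a : ℝ) (H : ℝ → ℝ → ℝ) (t u : ℝ) : ℝ≥0∞ :=
  if u ≤ t then ENNReal.ofReal (density H t u - a * H t u) else 0

namespace IsKernel

theorem measurable_survKernel (hk : IsKernel T lmin lmax H) :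
    Measurable (fun p : ℝ × ℝ => survKernel H p.1 p.2) := by
  have : (fun p : ℝ × ℝ => survKernel H p.1 p.2)
      = fun p : ℝ × ℝ => if p.2 ≤ p.1 then ENNReal.ofReal (survival H p.1 p.2) else 0 := by
    funext p
    by_cases h : p.2 ≤ p.1 <;> simp [survKernel, survival, h]
  rw [this]
  exact Measurable.ite (measurableSet_le measurable_snd measurable_fst)
    hk.measurable.ennreal_ofReal measurable_const

/-- A limit of jointly measurable difference quotients. The increments `1 / (n + 1)` point to the
right, so they never leave the region `u ≤ t` where `H` is meaningful. -/
theorem measurable_density_indicator (hk : IsKernel T lmin lmax H) :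
    Measurable (fun p : ℝ × ℝ => if p.2 ≤ p.1 then density H p.1 p.2 else 0) := by
  have hle : MeasurableSet {p : ℝ × ℝ | p.2 ≤ p.1} :=
    measurableSet_le measurable_snd measurable_fst
  refine measurable_of_tendsto_metrizable (f := fun (n : ℕ) (p : ℝ × ℝ) => if p.2 ≤ p.1 then
    -(((1 : ℝ) / (n + 1))⁻¹ * (survival H (p.1 + 1 / (n + 1)) p.2 - survival H p.1 p.2)) else 0)
    (fun n => Measurable.ite hle ?_ measurable_const) (tendsto_pi_nhds.2 fun p => ?_)
  · refine (((hk.measurable.comp (g := fun p : ℝ × ℝ => survival H p.1 p.2)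
      (f := fun p : ℝ × ℝ => (p.1 + 1 / ((n : ℝ) + 1), p.2)) ?_).sub hk.measurable).const_mul _).neg
    fun_prop
  · by_cases h : p.2 ≤ p.1
    · simp only [h, if_true]
      have h1 : HasDerivWithinAt (fun x => H x p.2) (-density H p.1 p.2) (Ioi p.1) p.1 :=
        (hk.hasDerivWithinAt h).mono fun x (hx : p.1 < x) => h.trans hx.le
      have h2 := hasDerivWithinAt_iff_tendsto_slope.1 h1
      have h3 : Tendsto (fun n : ℕ => p.1 + 1 / ((n : ℝ) + 1)) atTop (𝓝[Ioi p.1 \ {p.1}] p.1) := by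
        refine tendsto_nhdsWithin_iff.2 ⟨?_, Eventually.of_forall fun n => ?_⟩
        · simpa using tendsto_one_div_add_atTop_nhds_zero_nat.const_add p.1
        · have : (0 : ℝ) < 1 / ((n : ℝ) + 1) := by positivity
          exact ⟨by simpa using this, by simpa using this.ne'⟩
      have h4 := (h2.comp h3).neg
      rw [neg_neg] at h4
      refine h4.congr fun n => ?_
      have : (0 : ℝ) < 1 / ((n : ℝ) + 1) := by positivity
      simp only [Function.comp_def, slope, vsub_eq_sub, smul_eq_mul, survival, h, if_true]
      rw [if_pos (by linarith), add_sub_cancel_left]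
    · simp [h]

theorem measurable_arrivalKernel (hk : IsKernel T lmin lmax H) :
    Measurable (fun p : ℝ × ℝ => arrivalKernel H p.1 p.2) := by
  have : (fun p : ℝ × ℝ => arrivalKernel H p.1 p.2) = fun p : ℝ × ℝ =>
      ENNReal.ofReal (if p.2 ≤ p.1 then density H p.1 p.2 else 0) := by
    funext p
    by_cases h : p.2 ≤ p.1 <;> simp [arrivalKernel, h]
  rw [this]
  exact hk.measurable_density_indicator.ennreal_ofReal

theorem measurable_excessKernel (hk : IsKernel T lmin lmax H) (a : ℝ) :
    Measurable (fun p : ℝ × ℝ => excessKernel a H p.1 p.2) := by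
  have : (fun p : ℝ × ℝ => excessKernel a H p.1 p.2) = fun p : ℝ × ℝ =>
      if p.2 ≤ p.1 then ENNReal.ofReal
        ((if p.2 ≤ p.1 then density H p.1 p.2 else 0) - a * survival H p.1 p.2) else 0 := by
    funext p
    by_cases h : p.2 ≤ p.1 <;> simp [excessKernel, survival, h]
  rw [this]
  exact Measurable.ite (measurableSet_le measurable_snd measurable_fst)
    (hk.measurable_density_indicator.sub (hk.measurable.const_mul a)).ennreal_ofReal
    measurable_const

theorem measurable_survKernel_right (hk : IsKernel T lmin lmax H) (t : ℝ) :
    Measurable (survKernel H t) := hk.measurable_survKernel.comp measurable_prodMk_left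

theorem measurable_arrivalKernel_right (hk : IsKernel T lmin lmax H) (t : ℝ) :
    Measurable (arrivalKernel H t) := hk.measurable_arrivalKernel.comp measurable_prodMk_left

theorem measurable_excessKernel_right (hk : IsKernel T lmin lmax H) (a t : ℝ) :
    Measurable (excessKernel a H t) := (hk.measurable_excessKernel a).comp measurable_prodMk_left

theorem arrivalKernel_eq (hk : IsKernel T lmin lmax H) (hmin : 0 < lmin) (t u : ℝ) :
    arrivalKernel H t u = excessKernel lmin H t u + ENNReal.ofReal lmin * survKernel H t u := by
  by_cases h : u ≤ t
  · simp only [arrivalKernel, excessKernel, survKernel, h, if_true]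
    rw [← ENNReal.ofReal_mul hmin.le, ← ENNReal.ofReal_add]
    · simp
    · linarith [hk.le_density hmin h]
    · exact mul_nonneg hmin.le (hk.pos hmin h).le
  · simp [arrivalKernel, excessKernel, survKernel, h]

theorem arrivalKernel_le (hk : IsKernel T lmin lmax H) (hmin : 0 < lmin) (hmax : lmin < lmax)
    (t u : ℝ) : arrivalKernel H t u ≤ ENNReal.ofReal lmax * survKernel H t u := by
  by_cases h : u ≤ t
  · simp only [arrivalKernel, survKernel, h, if_true]
    rw [← ENNReal.ofReal_mul (hmin.trans hmax).le]
    exact ENNReal.ofReal_le_ofReal (hk.density_le hmin h)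
  · simp [arrivalKernel, h]

theorem excessKernel_le (hk : IsKernel T lmin lmax H) (hmin : 0 < lmin) (hmax : lmin < lmax)
    (t u : ℝ) :
    excessKernel lmin H t u ≤ ENNReal.ofReal (lmax - lmin) * survKernel H t u := by
  by_cases h : u ≤ t
  · simp only [excessKernel, survKernel, h, if_true]
    rw [← ENNReal.ofReal_mul (by linarith)]
    exact ENNReal.ofReal_le_ofReal (by linarith [hk.density_le hmin h])
  · simp [excessKernel, h]

theorem excessKernel_le' (hk : IsKernel T lmin lmax H) (hmin : 0 < lmin) (hmax : lmin < lmax)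
    (t u : ℝ) : excessKernel lmin H t u ≤ ENNReal.ofReal lmax * survKernel H t u :=
  (hk.excessKernel_le hmin hmax t u).trans
    (mul_le_mul_left (ENNReal.ofReal_le_ofReal (by linarith)) _)

theorem survKernel_le_exp (hk : IsKernel T lmin lmax H) (hmin : 0 < lmin) (t u : ℝ) :
    survKernel H t u ≤ (Iic t).indicator (fun v => ENNReal.ofReal (Real.exp (-lmin * (t - v)))) u := by
  by_cases h : u ≤ t
  · simp only [survKernel, h, if_true, indicator, mem_Iic]
    exact ENNReal.ofReal_le_ofReal (hk.le_exp hmin h)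
  · simp [survKernel, h]

theorem survKernel_le_exp_mul (hk : IsKernel T lmin lmax H) (hmin : 0 < lmin) (hus : u ≤ s)
    (hst : s ≤ t) :
    survKernel H t u ≤ ENNReal.ofReal (Real.exp (-lmin * (t - s))) * survKernel H s u := by
  simp only [survKernel, hus, hus.trans hst, if_true]
  rw [← ENNReal.ofReal_mul (Real.exp_pos _).le]
  exact ENNReal.ofReal_le_ofReal (hk.le_exp_mul hmin hus hst)

/-- Variation of constants started on the diagonal. The rate `a` is left free because both `a =
lmin` and `a = 0` are needed; `a ≤ lmin` keeps the excess nonnegative. -/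
theorem exp_eq_survKernel_add (hk : IsKernel T lmin lmax H) {a : ℝ}
    (hmin : 0 < lmin) (ha : a ≤ lmin) (h : u ≤ t) :
    ENNReal.ofReal (Real.exp (-a * (t - u))) = survKernel H t u +
      ∫⁻ x in Iic t, ENNReal.ofReal (Real.exp (-a * (t - x))) * excessKernel a H x u := by
  have h1 := hk.integral_exp_mul a le_rfl h
  rw [hk.diag, mul_one, intervalIntegral.integral_of_le h] at h1
  have hnn : ∀ x, u ≤ x → 0 ≤ Real.exp (-a * (t - x)) * (density H x u - a * H x u) := by
    intro x hx
    have h2 := hk.le_density hmin hx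
    have h3 := mul_le_mul_of_nonneg_right ha (hk.pos hmin hx).le
    exact mul_nonneg (Real.exp_pos _).le (by linarith)
  have h2 : ∫⁻ x in Iic t, ENNReal.ofReal (Real.exp (-a * (t - x))) * excessKernel a H x u
      = ∫⁻ x in Ioc u t, ENNReal.ofReal
          (Real.exp (-a * (t - x)) * (density H x u - a * H x u)) := by
    have : Icc u t ⊆ Iic t := fun x hx => hx.2
    rw [restrict_Ioc_eq_restrict_Icc, ← lintegral_indicator measurableSet_Iic,
      ← lintegral_indicator measurableSet_Icc]
    refine lintegral_congr fun x => ?_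
    by_cases hx : u ≤ x
    · by_cases hx' : x ≤ t <;>
        simp [indicator, hx, hx', excessKernel, ENNReal.ofReal_mul, (Real.exp_pos _).le]
    · simp [indicator, hx, excessKernel]
  rw [h2, ← ofReal_integral_eq_lintegral_ofReal, h1, survKernel, if_pos h, ← ENNReal.ofReal_add]
  · simp
  · exact (hk.pos hmin h).le
  · rw [← h1]
    exact setIntegral_nonneg measurableSet_Ioc fun x hx => hnn x hx.1.le
  · exact ((hk.continuousOn_exp_mul a t u).mono Icc_subset_Ici_self).integrableOn_Icc.mono_set
      Ioc_subset_Icc_self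
  · exact (ae_restrict_mem measurableSet_Ioc).mono fun x hx => hnn x hx.1.le

theorem survival_add_lintegral (hk : IsKernel T lmin lmax H) (hmin : 0 < lmin) (t u : ℝ) :
    ENNReal.ofReal (survival H t u) + ∫⁻ x in Iic t, arrivalKernel H x u = 1 := by
  by_cases h : u ≤ t
  -- At `a = 0` the exponential is `1` and the excess kernel is the full waiting time density.
  · have := hk.exp_eq_survKernel_add hmin hmin.le h
    simp only [neg_zero, zero_mul, Real.exp_zero, ENNReal.ofReal_one, one_mul] at this
    rw [this]
    simp [survival, survKernel, h, arrivalKernel, excessKernel]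
  · have : ∫⁻ x in Iic t, arrivalKernel H x u = 0 := by
      rw [← lintegral_zero (μ := volume.restrict (Iic t))]
      refine setLIntegral_congr_fun measurableSet_Iic fun x (hx : x ≤ t) => ?_
      simp [arrivalKernel, show ¬ u ≤ x from fun hux => h (hux.trans hx)]
    simp [survival, h, this]

end IsKernel

/-! ### Comparison principle for integral inequalities -/

/-- Inserting `d ≤ B * w` into the inequality improves it to `d ≤ (A + q * B) * w`, and iteration
converges to the fixed point `A * (1 - q)⁻¹`. The a priori constant `M` only starts the iteration
and disappears in the limit. -/
theorem le_mul_of_contraction {α : Type*} [MeasurableSpace α] {μ : Measure α} {S : Set α}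
    (hS : MeasurableSet S) {k : α → α → ℝ≥0∞} {d w : α → ℝ≥0∞} {A q M : ℝ≥0∞}
    (hA : A ≠ ∞) (hM : M ≠ ∞) (hq : q < 1) (hwt : ∀ t ∈ S, w t ≠ ∞)
    (hd : ∀ t ∈ S, d t ≤ A * w t + ∫⁻ u in S, k t u * d u ∂μ)
    (hw : ∀ t ∈ S, ∫⁻ u in S, k t u * w u ∂μ ≤ q * w t)
    (hb : ∀ t ∈ S, d t ≤ M * w t) : ∀ t ∈ S, d t ≤ A * (1 - q)⁻¹ * w t := by
  have hx : (1 - q)⁻¹ = 1 + q * (1 - q)⁻¹ := by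
    have h0 : 1 - q ≠ 0 := (tsub_pos_of_lt hq).ne'
    have h1 : (1 - q) * (1 - q)⁻¹ = 1 := ENNReal.mul_inv_cancel h0 (by simp)
    calc (1 - q)⁻¹ = ((1 - q) + q) * (1 - q)⁻¹ := by rw [tsub_add_cancel_of_le hq.le, one_mul]
      _ = _ := by rw [add_mul, h1]
  have hfin : A * (1 - q)⁻¹ ≠ ∞ :=
    ENNReal.mul_ne_top hA (ENNReal.inv_ne_top.2 (tsub_pos_of_lt hq).ne')
  have key : ∀ n : ℕ, ∀ t ∈ S, d t ≤ (A * (1 - q)⁻¹ + q ^ n * M) * w t := by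
    intro n
    induction n with
    | zero =>
      intro t ht
      refine (hb t ht).trans ?_
      gcongr
      simp
    | succ n ih =>
      intro t ht
      have hB : A * (1 - q)⁻¹ + q ^ n * M ≠ ∞ :=
        ENNReal.add_ne_top.2 ⟨hfin, ENNReal.mul_ne_top (ENNReal.pow_ne_top hq.ne_top) hM⟩
      calc d t ≤ A * w t + ∫⁻ u in S, k t u * d u ∂μ := hd t ht
        _ ≤ A * w t + ∫⁻ u in S, (A * (1 - q)⁻¹ + q ^ n * M) * (k t u * w u) ∂μ := by
          gcongr 1
          refine setLIntegral_mono' hS fun u hu => ?_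
          rw [mul_left_comm]
          gcongr
          exact ih u hu
        _ ≤ A * w t + (A * (1 - q)⁻¹ + q ^ n * M) * (q * w t) := by
          rw [lintegral_const_mul' _ _ hB]
          gcongr
          exact hw t ht
        _ = (A * (1 + q * (1 - q)⁻¹) + q ^ (n + 1) * M) * w t := by ring
        _ = _ := by rw [← hx]
  intro t ht
  have hlim : Tendsto (fun n : ℕ => (A * (1 - q)⁻¹ + q ^ n * M) * w t) atTop
      (𝓝 ((A * (1 - q)⁻¹ + 0 * M) * w t)) := by
    refine ENNReal.Tendsto.mul_const (Tendsto.add tendsto_const_nhds ?_) (Or.inr (hwt t ht))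
    exact ENNReal.Tendsto.mul_const (ENNReal.tendsto_pow_atTop_nhds_zero_of_lt_one hq) (Or.inr hM)
  rw [zero_mul, add_zero] at hlim
  exact ge_of_tendsto' hlim fun n => key n t ht

theorem lintegral_exp_Iic {a : ℝ} (ha : 0 < a) (t s : ℝ) :
    ∫⁻ x in Iic s, ENNReal.ofReal (Real.exp (-a * (t - x)))
      = ENNReal.ofReal (Real.exp (-a * (t - s)) / a) := by
  have h : ∀ x, Real.exp (-a * (t - x)) = Real.exp (-a * t) * Real.exp (a * x) := fun x => by
    rw [← Real.exp_add]; ring_nf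
  rw [← ofReal_integral_eq_lintegral_ofReal]
  · simp only [h, integral_const_mul, integral_exp_mul_Iic ha, mul_div_assoc]
  · simp only [h]
    exact (integrableOn_exp_mul_Iic ha s).const_mul _
  · exact Eventually.of_forall fun x => (Real.exp_pos _).le

/-! ### Construction of the stationary profile -/

/-- Monotone approximations of the density of the stationary arrival times. -/
noncomputable def profileIter (a : ℝ) (H : ℝ → ℝ → ℝ) : ℕ → ℝ → ℝ≥0∞
  | 0 => fun _ => 0
  | n + 1 => fun t => ENNReal.ofReal a + ∫⁻ u, excessKernel a H t u * profileIter a H n u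

/-- The density of the stationary arrival times. -/
noncomputable def profile (a : ℝ) (H : ℝ → ℝ → ℝ) (t : ℝ) : ℝ≥0∞ := ⨆ n, profileIter a H n t

namespace IsKernel

theorem measurable_profileIter (hk : IsKernel T lmin lmax H) (a : ℝ) (n : ℕ) :
    Measurable (profileIter a H n) := by
  induction n with
  | zero => exact measurable_const
  | succ n ih =>
    have h : Measurable fun t => ∫⁻ u, excessKernel a H t u * profileIter a H n u :=
      Measurable.lintegral_prod_right'
        (f := fun p : ℝ × ℝ => excessKernel a H p.1 p.2 * profileIter a H n p.2)
        ((hk.measurable_excessKernel a).mul (ih.comp measurable_snd))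
    exact h.const_add _

theorem measurable_profile (hk : IsKernel T lmin lmax H) (a : ℝ) : Measurable (profile a H) :=
  Measurable.iSup fun n => hk.measurable_profileIter a n

theorem monotone_profileIter (a : ℝ) (H : ℝ → ℝ → ℝ) : Monotone (profileIter a H) := by
  refine monotone_nat_of_le_succ fun n => ?_
  induction n with
  | zero => exact fun t => zero_le
  | succ n ih =>
    intro t
    refine add_le_add le_rfl (lintegral_mono fun u => ?_)
    exact mul_le_mul_right (ih u) _

theorem profile_eq (hk : IsKernel T lmin lmax H) (a t : ℝ) :
    profile a H t = ENNReal.ofReal a + ∫⁻ u, excessKernel a H t u * profile a H u := by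
  have h1 : ∫⁻ u, excessKernel a H t u * profile a H u
      = ⨆ n, ∫⁻ u, excessKernel a H t u * profileIter a H n u := by
    simp only [profile, ENNReal.mul_iSup]
    refine lintegral_iSup (fun n => (hk.measurable_excessKernel_right a t).mul
      (hk.measurable_profileIter a n)) fun m n hmn u => ?_
    exact mul_le_mul_right (monotone_profileIter a H hmn u) _
  rw [h1, ENNReal.add_iSup]
  refine le_antisymm (iSup_le fun n => ?_) (iSup_le fun n => le_iSup_of_le (n + 1) le_rfl)
  exact (monotone_profileIter a H n.le_succ t).trans (le_iSup_of_le n le_rfl)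

theorem indicator_exp_eq (hk : IsKernel T lmin lmax H) (hmin : 0 < lmin) (t u : ℝ) :
    (Iic t).indicator (fun v => ENNReal.ofReal (Real.exp (-lmin * (t - v)))) u = survKernel H t u +
      ∫⁻ x in Iic t, ENNReal.ofReal (Real.exp (-lmin * (t - x))) * excessKernel lmin H x u := by
  by_cases h : u ≤ t
  · rw [← hk.exp_eq_survKernel_add hmin le_rfl h]
    simp [h]
  · have : ∫⁻ x in Iic t, ENNReal.ofReal (Real.exp (-lmin * (t - x))) * excessKernel lmin H x u
        = 0 := by
      rw [← lintegral_zero (μ := volume.restrict (Iic t))]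
      refine setLIntegral_congr_fun measurableSet_Iic fun x (hx : x ≤ t) => ?_
      simp [excessKernel, show ¬ u ≤ x from fun hux => h (hux.trans hx)]
    rw [this]
    simp [survKernel, h]

/-- Variation of constants integrated against `f`, with Tonelli. It relates the `H`-mass of `f` to
exponential averages of `f` and of its image under the excess kernel. -/
theorem lintegral_exp_mul_eq (hk : IsKernel T lmin lmax H) (hmin : 0 < lmin) (t : ℝ)
    {f : ℝ → ℝ≥0∞} (hf : Measurable f) :
    ∫⁻ u in Iic t, ENNReal.ofReal (Real.exp (-lmin * (t - u))) * f u
      = (∫⁻ u, survKernel H t u * f u) + ∫⁻ x in Iic t,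
        ENNReal.ofReal (Real.exp (-lmin * (t - x))) * ∫⁻ u, excessKernel lmin H x u * f u := by
  have hme : Measurable (Function.uncurry fun x u => ENNReal.ofReal (Real.exp (-lmin * (t - x)))
      * (excessKernel lmin H x u * f u)) := by
    unfold Function.uncurry
    have := hk.measurable_excessKernel lmin
    fun_prop
  have h1 : ∫⁻ x in Iic t, ENNReal.ofReal (Real.exp (-lmin * (t - x))) *
        ∫⁻ u, excessKernel lmin H x u * f u
      = ∫⁻ u, ∫⁻ x in Iic t, ENNReal.ofReal (Real.exp (-lmin * (t - x))) *
          (excessKernel lmin H x u * f u) := by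
    rw [← lintegral_lintegral_swap hme.aemeasurable]
    refine lintegral_congr fun x => ?_
    rw [lintegral_const_mul' _ _ (by simp)]
  rw [h1, ← lintegral_add_left ((hk.measurable_survKernel_right t).fun_mul hf),
    ← lintegral_indicator measurableSet_Iic]
  refine lintegral_congr fun u => ?_
  have h2 : ∫⁻ x in Iic t, ENNReal.ofReal (Real.exp (-lmin * (t - x))) *
        (excessKernel lmin H x u * f u)
      = (∫⁻ x in Iic t, ENNReal.ofReal (Real.exp (-lmin * (t - x))) * excessKernel lmin H x u)
        * f u := by
    rw [← lintegral_mul_const _ ?_]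
    · simp only [mul_assoc]
    · have : Measurable fun x => excessKernel lmin H x u :=
        (hk.measurable_excessKernel lmin).comp measurable_prodMk_right
      fun_prop
  rw [h2, ← add_mul, ← hk.indicator_exp_eq hmin t u]
  by_cases h : u ≤ t <;> simp [h]

theorem lintegral_exp_mul_ne_top (hmin : 0 < lmin) {f : ℝ → ℝ≥0∞} {B : ℝ≥0∞} (hB : B ≠ ∞)
    (hf : ∀ u, f u ≤ B) (t : ℝ) :
    ∫⁻ u in Iic t, ENNReal.ofReal (Real.exp (-lmin * (t - u))) * f u ≠ ∞ := by
  refine ne_top_of_le_ne_top ?_ (lintegral_mono fun u => mul_le_mul_right (hf u) _)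
  rw [lintegral_mul_const' _ _ hB, lintegral_exp_Iic hmin]
  exact ENNReal.mul_ne_top ENNReal.ofReal_ne_top hB

theorem lintegral_exp_mul_add (hmin : 0 < lmin) {f : ℝ → ℝ≥0∞} (t : ℝ) :
    ∫⁻ u in Iic t, ENNReal.ofReal (Real.exp (-lmin * (t - u))) * (ENNReal.ofReal lmin + f u)
      = 1 + ∫⁻ u in Iic t, ENNReal.ofReal (Real.exp (-lmin * (t - u))) * f u := by
  simp only [mul_add]
  rw [lintegral_add_left (by fun_prop), lintegral_mul_const' _ _ ENNReal.ofReal_ne_top,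
    lintegral_exp_Iic hmin, ← ENNReal.ofReal_mul (by positivity)]
  simp [hmin.ne']

/-- Averaging `ρₙ ≤ ρₙ₊₁ = lmin + ∫ E ρₙ` against the exponential kernel, where the source
contributes exactly `1`, leaves the same excess term on both sides. The bound `B` only makes that
term finite, so that it cancels. -/
theorem lintegral_survKernel_mul_profileIter_le (hk : IsKernel T lmin lmax H) (hmin : 0 < lmin)
    {n : ℕ} {B : ℝ≥0∞} (hB : B ≠ ∞) (hf : ∀ u, profileIter lmin H n u ≤ B) (t : ℝ) :
    ∫⁻ u, survKernel H t u * profileIter lmin H n u ≤ 1 := by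
  have h1 := hk.lintegral_exp_mul_eq hmin t (hk.measurable_profileIter lmin n)
  have h2 : ∫⁻ u in Iic t, ENNReal.ofReal (Real.exp (-lmin * (t - u))) * profileIter lmin H n u
      ≤ 1 + ∫⁻ x in Iic t, ENNReal.ofReal (Real.exp (-lmin * (t - x))) *
        ∫⁻ u, excessKernel lmin H x u * profileIter lmin H n u := by
    rw [← lintegral_exp_mul_add hmin]
    exact lintegral_mono fun x => mul_le_mul_right (monotone_profileIter lmin H n.le_succ x) _
  have h3 := lintegral_exp_mul_ne_top hmin hB hf t
  rw [h1] at h2 h3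
  exact (ENNReal.add_le_add_iff_right (ENNReal.add_ne_top.1 h3).2).1 h2

/-- The inductive bound is used only for finiteness. The value `lmax` comes from mass at most one
and `E ≤ (lmax - lmin) H`. -/
theorem profileIter_le (hk : IsKernel T lmin lmax H) (hmin : 0 < lmin) (hmax : lmin < lmax)
    (n : ℕ) (t : ℝ) : profileIter lmin H n t ≤ ENNReal.ofReal lmax := by
  induction n generalizing t with
  | zero => exact zero_le
  | succ n ih =>
    calc profileIter lmin H (n + 1) t
        ≤ ENNReal.ofReal lmin + ∫⁻ u, ENNReal.ofReal (lmax - lmin) *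
            (survKernel H t u * profileIter lmin H n u) := by
          refine add_le_add le_rfl (lintegral_mono fun u => ?_)
          rw [← mul_assoc]
          exact mul_le_mul_left (hk.excessKernel_le hmin hmax t u) _
      _ ≤ ENNReal.ofReal lmin + ENNReal.ofReal (lmax - lmin) * 1 := by
          rw [lintegral_const_mul' _ _ ENNReal.ofReal_ne_top]
          gcongr
          exact hk.lintegral_survKernel_mul_profileIter_le hmin ENNReal.ofReal_ne_top ih t
      _ = ENNReal.ofReal lmax := by
          rw [mul_one, ← ENNReal.ofReal_add hmin.le (by linarith)]
          ring_nf

theorem profile_le (hk : IsKernel T lmin lmax H) (hmin : 0 < lmin) (hmax : lmin < lmax) (t : ℝ) :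
    profile lmin H t ≤ ENNReal.ofReal lmax :=
  iSup_le fun n => hk.profileIter_le hmin hmax n t

theorem profile_ne_top (hk : IsKernel T lmin lmax H) (hmin : 0 < lmin) (hmax : lmin < lmax)
    (t : ℝ) : profile lmin H t ≠ ∞ :=
  ne_top_of_le_ne_top ENNReal.ofReal_ne_top (hk.profile_le hmin hmax t)

theorem le_profile (hk : IsKernel T lmin lmax H) (t : ℝ) :
    ENNReal.ofReal lmin ≤ profile lmin H t := by
  rw [hk.profile_eq]
  exact le_self_add

/-- The cancellation used for the iterates, now with equality because the profile is a fixed point.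
-/
theorem lintegral_survKernel_mul_profile (hk : IsKernel T lmin lmax H) (hmin : 0 < lmin)
    (hmax : lmin < lmax) (t : ℝ) : ∫⁻ u, survKernel H t u * profile lmin H u = 1 := by
  have h1 := hk.lintegral_exp_mul_eq hmin t (hk.measurable_profile lmin)
  have h3 := lintegral_exp_mul_ne_top hmin ENNReal.ofReal_ne_top (hk.profile_le hmin hmax) t
  have h2 : ∫⁻ u in Iic t, ENNReal.ofReal (Real.exp (-lmin * (t - u))) * profile lmin H u
      = 1 + ∫⁻ x in Iic t, ENNReal.ofReal (Real.exp (-lmin * (t - x))) *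
        ∫⁻ u, excessKernel lmin H x u * profile lmin H u := by
    rw [← lintegral_exp_mul_add hmin]
    exact lintegral_congr fun x => by rw [← hk.profile_eq]
  rw [h1] at h2 h3
  exact (ENNReal.add_left_inj (ENNReal.add_ne_top.1 h3).2).1 h2

theorem lintegral_arrivalKernel_mul_profile (hk : IsKernel T lmin lmax H) (hmin : 0 < lmin)
    (hmax : lmin < lmax) (t : ℝ) :
    ∫⁻ u, arrivalKernel H t u * profile lmin H u = profile lmin H t := by
  have h : ∀ u, arrivalKernel H t u * profile lmin H u = excessKernel lmin H t u * profile lmin H u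
      + ENNReal.ofReal lmin * (survKernel H t u * profile lmin H u) := fun u => by
    rw [hk.arrivalKernel_eq hmin]; ring
  simp only [h]
  rw [lintegral_add_left ((hk.measurable_excessKernel_right _ t).fun_mul (hk.measurable_profile _)),
    lintegral_const_mul' _ _ ENNReal.ofReal_ne_top, hk.lintegral_survKernel_mul_profile hmin hmax,
    mul_one, add_comm, ← hk.profile_eq]

theorem excessKernel_periodic (hk : IsKernel T lmin lmax H) (a t u : ℝ) :
    excessKernel a H (t + T) (u + T) = excessKernel a H t u := by
  by_cases h : u ≤ t
  · simp [excessKernel, h, hk.periodic t u h, hk.density_periodic h]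
  · simp [excessKernel, h]

theorem profile_periodic (hk : IsKernel T lmin lmax H) (a : ℝ) :
    Function.Periodic (profile a H) T := by
  have : ∀ n t, profileIter a H n (t + T) = profileIter a H n t := by
    intro n
    induction n with
    | zero => exact fun t => rfl
    | succ n ih =>
      intro t
      simp only [profileIter]
      rw [← lintegral_add_right_eq_self _ T]
      simp only [ih, hk.excessKernel_periodic]
  intro t
  simp only [profile, this]

/-- Convexity of `exp` between `0` and `y`. It trades a small exponential rate for a small multiple
of a large one. -/
theorem exp_mul_le {θ : ℝ} (h0 : 0 ≤ θ) (h1 : θ ≤ 1) (y : ℝ) :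
    Real.exp (θ * y) ≤ 1 + θ * Real.exp y := by
  have := convexOn_exp.2 (mem_univ 0) (mem_univ y) (sub_nonneg.2 h1) h0 (by ring)
  simp only [smul_eq_mul, mul_zero, zero_add, Real.exp_zero, mul_one] at this
  linarith

end IsKernel

/-! ### Contraction with exponential weights -/

/-- The exponential rate of convergence to the stationary regime. -/
noncomputable def rate (lmin lmax : ℝ) : ℝ := lmin ^ 2 / (4 * lmax ^ 2) * (lmin / 2)

theorem rate_pos (hmin : 0 < lmin) (hmax : lmin < lmax) : 0 < rate lmin lmax := by
  have := hmin.trans hmax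
  unfold rate
  positivity

theorem sq_div_le_one (hmin : 0 < lmin) (hmax : lmin < lmax) :
    lmin ^ 2 / (4 * lmax ^ 2) ≤ 1 := by
  have := hmin.trans hmax
  rw [div_le_one (by positivity)]
  nlinarith

theorem rate_le (hmin : 0 < lmin) (hmax : lmin < lmax) : rate lmin lmax ≤ lmin := by
  have := sq_div_le_one hmin hmax
  unfold rate
  nlinarith

namespace IsKernel

/-- The decay of `H` at rate `lmin` absorbs growth at rate `lmin / 2`, leaving an integral equal to
`2 / lmin`. The prefactor is chosen so that, after multiplication by `lmax`, the result is `lmin /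
2`, half of the source. -/
theorem lintegral_exp_half_mul_survKernel_le (hk : IsKernel T lmin lmax H) (hmin : 0 < lmin)
    (hmax : lmin < lmax) (t : ℝ) :
    ∫⁻ u, ENNReal.ofReal (lmin ^ 2 / (4 * lmax ^ 2) * Real.exp (lmin / 2 * (t - u))) *
      (survKernel H t u * profile lmin H u) ≤ ENNReal.ofReal (lmin / (2 * lmax)) := by
  have hL := hmin.trans hmax
  have hle : ∀ u, ENNReal.ofReal (lmin ^ 2 / (4 * lmax ^ 2) * Real.exp (lmin / 2 * (t - u))) *
      (survKernel H t u * profile lmin H u) ≤ ENNReal.ofReal (lmin ^ 2 / (4 * lmax ^ 2) * lmax) *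
        (Iic t).indicator (fun v => ENNReal.ofReal (Real.exp (-(lmin / 2) * (t - v)))) u := by
    intro u
    by_cases h : u ≤ t
    · calc _ ≤ ENNReal.ofReal (lmin ^ 2 / (4 * lmax ^ 2) * Real.exp (lmin / 2 * (t - u))) *
            (ENNReal.ofReal (Real.exp (-lmin * (t - u))) * ENNReal.ofReal lmax) := by
            gcongr
            · simpa [h] using hk.survKernel_le_exp hmin t u
            · exact hk.profile_le hmin hmax u
        _ = _ := by
            simp only [indicator, mem_Iic, h, if_true]
            rw [← ENNReal.ofReal_mul (by positivity), ← ENNReal.ofReal_mul (by positivity),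
              ← ENNReal.ofReal_mul (by positivity)]
            congr 1
            rw [show -(lmin / 2) * (t - u) = lmin / 2 * (t - u) + -lmin * (t - u) by ring,
              Real.exp_add]
            ring
    · simp [survKernel, h]
  refine (lintegral_mono hle).trans ?_
  rw [lintegral_const_mul' _ _ ENNReal.ofReal_ne_top, lintegral_indicator measurableSet_Iic,
    lintegral_exp_Iic (by positivity), ← ENNReal.ofReal_mul (by positivity)]
  refine ENNReal.ofReal_le_ofReal (le_of_eq ?_)
  simp only [sub_self, mul_zero, Real.exp_zero]
  field_simp
  norm_num

theorem ofReal_exp_rate_mul_le (hmin : 0 < lmin) (hmax : lmin < lmax) (x : ℝ) :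
    ENNReal.ofReal (Real.exp (rate lmin lmax * x)) ≤
      1 + ENNReal.ofReal (lmin ^ 2 / (4 * lmax ^ 2) * Real.exp (lmin / 2 * x)) := by
  have hL := hmin.trans hmax
  rw [← ENNReal.ofReal_one, ← ENNReal.ofReal_add zero_le_one (by positivity), rate, mul_assoc]
  exact ENNReal.ofReal_le_ofReal
    (exp_mul_le (by positivity) (sq_div_le_one hmin hmax) (lmin / 2 * x))

theorem lintegral_exp_rate_mul_survKernel_le (hk : IsKernel T lmin lmax H) (hmin : 0 < lmin)
    (hmax : lmin < lmax) (t : ℝ) :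
    ∫⁻ u, ENNReal.ofReal (Real.exp (rate lmin lmax * (t - u))) *
      (survKernel H t u * profile lmin H u) ≤ 2 := by
  have hL := hmin.trans hmax
  calc _ ≤ ∫⁻ u, (survKernel H t u * profile lmin H u +
          ENNReal.ofReal (lmin ^ 2 / (4 * lmax ^ 2) * Real.exp (lmin / 2 * (t - u))) *
            (survKernel H t u * profile lmin H u)) := by
        refine lintegral_mono fun u => ?_
        refine (mul_le_mul_left (ofReal_exp_rate_mul_le hmin hmax (t - u)) _).trans (le_of_eq ?_)
        rw [add_mul, one_mul]
    _ ≤ 1 + ENNReal.ofReal (lmin / (2 * lmax)) := by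
        rw [lintegral_add_left ((hk.measurable_survKernel_right t).fun_mul (hk.measurable_profile _)),
          hk.lintegral_survKernel_mul_profile hmin hmax]
        gcongr
        exact hk.lintegral_exp_half_mul_survKernel_le hmin hmax t
    _ ≤ 1 + 1 := by
        gcongr
        rw [ENNReal.ofReal_le_one, div_le_one (by positivity)]
        linarith
    _ = 2 := one_add_one_eq_two

/-- Without the weight the integral is `ρ(t) - lmin`, and the weight costs at most `lmin / 2`. The
remaining `lmin / 2` is at least `lmin / (2 * lmax) * ρ(t)` because `ρ ≤ lmax`. -/
theorem lintegral_exp_rate_mul_excessKernel_le (hk : IsKernel T lmin lmax H) (hmin : 0 < lmin)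
    (hmax : lmin < lmax) (t : ℝ) :
    ∫⁻ u, ENNReal.ofReal (Real.exp (rate lmin lmax * (t - u))) *
      (excessKernel lmin H t u * profile lmin H u)
        ≤ ENNReal.ofReal (1 - lmin / (2 * lmax)) * profile lmin H t := by
  have hL := hmin.trans hmax
  have hp := hk.profile_eq lmin t
  set X := ∫⁻ u, excessKernel lmin H t u * profile lmin H u with hX
  have h1 : ∫⁻ u, ENNReal.ofReal (Real.exp (rate lmin lmax * (t - u))) *
      (excessKernel lmin H t u * profile lmin H u) ≤ X + ENNReal.ofReal (lmin / 2) := by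
    calc _ ≤ ∫⁻ u, (excessKernel lmin H t u * profile lmin H u +
          ENNReal.ofReal lmax * (ENNReal.ofReal (lmin ^ 2 / (4 * lmax ^ 2) *
            Real.exp (lmin / 2 * (t - u))) * (survKernel H t u * profile lmin H u))) := by
          refine lintegral_mono fun u => ?_
          refine (mul_le_mul_left (ofReal_exp_rate_mul_le hmin hmax (t - u)) _).trans ?_
          rw [add_mul, one_mul, mul_left_comm (ENNReal.ofReal lmax), ← mul_assoc (ENNReal.ofReal lmax)]
          gcongr
          exact hk.excessKernel_le' hmin hmax t u
      _ ≤ X + ENNReal.ofReal lmax * ENNReal.ofReal (lmin / (2 * lmax)) := by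
          rw [lintegral_add_left ((hk.measurable_excessKernel_right _ t).fun_mul
            (hk.measurable_profile _)), lintegral_const_mul' _ _ ENNReal.ofReal_ne_top]
          gcongr
          exact hk.lintegral_exp_half_mul_survKernel_le hmin hmax t
      _ = _ := by
          rw [← ENNReal.ofReal_mul hL.le]
          congr 2
          field_simp
  refine h1.trans ?_
  have h2 : ENNReal.ofReal (lmin / (2 * lmax)) * profile lmin H t ≤ ENNReal.ofReal (lmin / 2) := by
    refine (mul_le_mul_right (hk.profile_le hmin hmax t) _).trans (le_of_eq ?_)
    rw [← ENNReal.ofReal_mul (by positivity)]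
    congr 1
    field_simp
  have h3 : ENNReal.ofReal (1 - lmin / (2 * lmax)) * profile lmin H t
      + ENNReal.ofReal (lmin / (2 * lmax)) * profile lmin H t = profile lmin H t := by
    rw [← add_mul, ← ENNReal.ofReal_add _ (by positivity)]
    · simp
    · rw [sub_nonneg, div_le_one (by positivity)]
      linarith
  refine (ENNReal.add_le_add_iff_right (a := ENNReal.ofReal (lmin / 2)) ENNReal.ofReal_ne_top).1 ?_
  calc X + ENNReal.ofReal (lmin / 2) + ENNReal.ofReal (lmin / 2) = profile lmin H t := by
        rw [add_assoc, ← ENNReal.ofReal_add (by positivity) (by positivity), add_halves, add_comm,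
          ← hp]
    _ ≤ _ := by
        conv_lhs => rw [← h3]
        gcongr

end IsKernel

/-! ### The profile as a real function -/

theorem setLIntegral_Iic_eq_lintegral {f : ℝ → ℝ≥0∞} (hf : ∀ u, ¬ u ≤ t → f u = 0) :
    ∫⁻ u in Iic t, f u = ∫⁻ u, f u := by
  rw [← lintegral_indicator measurableSet_Iic]
  refine lintegral_congr fun u => ?_
  by_cases h : u ≤ t
  · simp [h]
  · simp [h, hf u h]

theorem survKernel_of_not_le (h : ¬ u ≤ t) : survKernel H t u = 0 := if_neg h

theorem arrivalKernel_of_not_le (h : ¬ u ≤ t) : arrivalKernel H t u = 0 := if_neg h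

theorem excessKernel_of_not_le {a : ℝ} (h : ¬ u ≤ t) : excessKernel a H t u = 0 := if_neg h

namespace IsKernel

theorem toReal_survKernel (hk : IsKernel T lmin lmax H) (hmin : 0 < lmin) (h : u ≤ t) :
    (survKernel H t u).toReal = H t u := by
  rw [survKernel, if_pos h, ENNReal.toReal_ofReal (hk.pos hmin h).le]

theorem toReal_arrivalKernel (hk : IsKernel T lmin lmax H) (hmin : 0 < lmin) (h : u ≤ t) :
    (arrivalKernel H t u).toReal = density H t u := by
  rw [arrivalKernel, if_pos h, ENNReal.toReal_ofReal (hk.density_nonneg hmin h)]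

theorem survKernel_ne_top (t u : ℝ) : survKernel H t u ≠ ∞ := by
  unfold survKernel; split_ifs <;> simp

theorem arrivalKernel_ne_top (t u : ℝ) : arrivalKernel H t u ≠ ∞ := by
  unfold arrivalKernel; split_ifs <;> simp

theorem integral_survKernel_mul_profile (hk : IsKernel T lmin lmax H) (hmin : 0 < lmin)
    (hmax : lmin < lmax) (t : ℝ) : ∫ u in Iic t, H t u * (profile lmin H u).toReal = 1 := by
  have h1 : ∫ u in Iic t, H t u * (profile lmin H u).toReal
      = ∫ u in Iic t, (survKernel H t u * profile lmin H u).toReal :=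
    setIntegral_congr_fun measurableSet_Iic fun u (hu : u ≤ t) => by
      simp only [ENNReal.toReal_mul, hk.toReal_survKernel hmin hu]
  rw [h1, integral_toReal
    ((hk.measurable_survKernel_right t).fun_mul (hk.measurable_profile lmin)).aemeasurable
    (Eventually.of_forall fun u => ENNReal.mul_lt_top (survKernel_ne_top t u).lt_top
      (hk.profile_ne_top hmin hmax u).lt_top),
    setLIntegral_Iic_eq_lintegral fun u hu => by rw [survKernel_of_not_le hu, zero_mul],
    hk.lintegral_survKernel_mul_profile hmin hmax, ENNReal.toReal_one]

theorem integral_density_mul_profile (hk : IsKernel T lmin lmax H) (hmin : 0 < lmin)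
    (hmax : lmin < lmax) (t : ℝ) :
    ∫ u in Iic t, density H t u * (profile lmin H u).toReal = (profile lmin H t).toReal := by
  have h1 : ∫ u in Iic t, density H t u * (profile lmin H u).toReal
      = ∫ u in Iic t, (arrivalKernel H t u * profile lmin H u).toReal :=
    setIntegral_congr_fun measurableSet_Iic fun u (hu : u ≤ t) => by
      simp only [ENNReal.toReal_mul, hk.toReal_arrivalKernel hmin hu]
  rw [h1, integral_toReal
    ((hk.measurable_arrivalKernel_right t).fun_mul (hk.measurable_profile lmin)).aemeasurable
    (Eventually.of_forall fun u => ENNReal.mul_lt_top (arrivalKernel_ne_top t u).lt_top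
      (hk.profile_ne_top hmin hmax u).lt_top),
    setLIntegral_Iic_eq_lintegral fun u hu => by rw [arrivalKernel_of_not_le hu, zero_mul],
    hk.lintegral_arrivalKernel_mul_profile hmin hmax]

theorem isProfile_profile (hk : IsKernel T lmin lmax H) (hmin : 0 < lmin) (hmax : lmin < lmax) :
    IsProfile T H (fun t => (profile lmin H t).toReal) where
  periodic := fun t => by simp only [hk.profile_periodic lmin t]
  integrableOn := by
    refine Measure.integrableOn_of_bounded (M := lmax) (by simp)
      (hk.measurable_profile lmin).ennreal_toReal.aestronglyMeasurable
      (Eventually.of_forall fun t => ?_)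
    rw [Real.norm_of_nonneg ENNReal.toReal_nonneg]
    exact ENNReal.toReal_le_of_le_ofReal (hmin.trans hmax).le (hk.profile_le hmin hmax t)
  eq_integral := fun t => (hk.integral_density_mul_profile hmin hmax t).symm
  normalized := fun t => hk.integral_survKernel_mul_profile hmin hmax t

end IsKernel

/-! ### Bounds for arbitrary periodic solutions, and uniqueness -/

theorem setLIntegral_Ioc_of_periodic (hT : 0 < T) {f : ℝ → ℝ≥0∞} (hf : Function.Periodic f T)
    (a b : ℝ) : ∫⁻ u in Ioc a (a + T), f u = ∫⁻ u in Ioc b (b + T), f u := by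
  refine (isAddFundamentalDomain_Ioc hT a).setLIntegral_eq (isAddFundamentalDomain_Ioc hT b) f ?_
  rintro ⟨g, hg⟩ x
  obtain ⟨n, rfl⟩ := AddSubgroup.mem_zmultiples_iff.1 hg
  rw [AddSubgroup.mk_vadd, vadd_eq_add, add_comm]
  exact hf.zsmul n x

/-- The half-line is cut into periods going back from `t`. Each carries the same integral of `f`,
damped by a geometric factor. -/
theorem lintegral_exp_mul_le_of_periodic (hT : 0 < T) {a : ℝ} (ha : 0 < a) {f : ℝ → ℝ≥0∞}
    (hf : Function.Periodic f T) (t : ℝ) :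
    ∫⁻ u in Iic t, ENNReal.ofReal (Real.exp (-a * (t - u))) * f u
      ≤ (1 - ENNReal.ofReal (Real.exp (-a * T)))⁻¹ * ∫⁻ u in Ioc 0 T, f u := by
  have hsub : Iic t ⊆ ⋃ n : ℕ, Ioc (t - n * T - T) (t - n * T - T + T) := by
    intro u (hu : u ≤ t)
    have h0 : 0 ≤ (t - u) / T := div_nonneg (by linarith) hT.le
    have h1 := (le_div_iff₀ hT).1 (Nat.floor_le h0)
    have h2 := (div_lt_iff₀ hT).1 (Nat.lt_floor_add_one ((t - u) / T))
    exact mem_iUnion.2 ⟨⌊(t - u) / T⌋₊, by constructor <;> linarith⟩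
  calc _ ≤ ∑' n : ℕ, ∫⁻ u in Ioc (t - n * T - T) (t - n * T - T + T),
          ENNReal.ofReal (Real.exp (-a * (t - u))) * f u :=
        (lintegral_mono_set hsub).trans (lintegral_iUnion_le _ _)
    _ ≤ ∑' n : ℕ, ENNReal.ofReal (Real.exp (-a * T)) ^ n * ∫⁻ u in Ioc 0 T, f u := by
        refine ENNReal.tsum_le_tsum fun n => ?_
        have := setLIntegral_Ioc_of_periodic hT hf 0 (t - n * T - T)
        rw [zero_add] at this
        rw [this, ← ENNReal.ofReal_pow (Real.exp_pos _).le, ← Real.exp_nat_mul,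
          ← lintegral_const_mul' _ _ ENNReal.ofReal_ne_top]
        refine setLIntegral_mono' measurableSet_Ioc fun u hu => ?_
        refine mul_le_mul_left (ENNReal.ofReal_le_ofReal (Real.exp_le_exp.2 ?_)) _
        have := hu.2
        nlinarith
    _ = _ := by rw [ENNReal.tsum_mul_right, ENNReal.tsum_geometric]

namespace IsProfile

variable {ρ : ℝ → ℝ}

theorem aestronglyMeasurable (hp : IsProfile T H ρ) (hT : 0 < T) :
    AEStronglyMeasurable ρ volume := by
  have h1 : IntervalIntegrable ρ volume 0 (0 + T) := by
    rw [zero_add]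
    exact (intervalIntegrable_iff_integrableOn_Ioc_of_le hT.le).2 hp.integrableOn
  have h2 := hp.periodic.intervalIntegrable hT.ne' h1
  exact (aecover_Ioc (μ := volume) tendsto_neg_atTop_atBot tendsto_id).aestronglyMeasurable
    fun x => (h2 (-x) x).1.aestronglyMeasurable

theorem lintegral_exp_mul_enorm_le (hp : IsProfile T H ρ) (hT : 0 < T) {a : ℝ} (ha : 0 < a) :
    ∃ B : ℝ≥0∞, B ≠ ∞ ∧
      ∀ t, ∫⁻ u in Iic t, ENNReal.ofReal (Real.exp (-a * (t - u))) * ‖ρ u‖ₑ ≤ B := by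
  refine ⟨_, ?_, fun t => lintegral_exp_mul_le_of_periodic hT ha (f := fun u => ‖ρ u‖ₑ)
    (fun u => by simp only [hp.periodic u]) t⟩
  refine ENNReal.mul_ne_top (ENNReal.inv_ne_top.2 (tsub_pos_of_lt ?_).ne') hp.integrableOn.2.ne
  rw [ENNReal.ofReal_lt_one, Real.exp_lt_one_iff]
  nlinarith

theorem integrableOn_mul (hp : IsProfile T H ρ) (hT : 0 < T) (hmin : 0 < lmin) {C : ℝ}
    {f : ℝ → ℝ} (hfm : AEStronglyMeasurable f (volume.restrict (Iic t)))
    (hf : ∀ u ≤ t, |f u| ≤ C * Real.exp (-lmin * (t - u))) :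
    IntegrableOn (fun u => f u * ρ u) (Iic t) := by
  obtain ⟨B, hB, hle⟩ := hp.lintegral_exp_mul_enorm_le hT hmin
  refine ⟨hfm.mul (hp.aestronglyMeasurable hT).restrict, ?_⟩
  have hlt : ENNReal.ofReal C * B < ∞ := ENNReal.mul_lt_top ENNReal.ofReal_lt_top hB.lt_top
  refine lt_of_le_of_lt ?_ hlt
  refine le_trans ?_ (mul_le_mul_right (hle t) (ENNReal.ofReal C))
  rw [← lintegral_const_mul' _ _ ENNReal.ofReal_ne_top]
  refine setLIntegral_mono' measurableSet_Iic fun u hu => ?_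
  rw [enorm_mul, ← mul_assoc, ← ENNReal.ofReal_mul' (Real.exp_pos _).le, Real.enorm_eq_ofReal_abs]
  gcongr
  exact hf u hu

end IsProfile

namespace IsKernel

theorem abs_survKernel_le (hk : IsKernel T lmin lmax H) (hmin : 0 < lmin) (h : u ≤ t) :
    |H t u| ≤ 1 * Real.exp (-lmin * (t - u)) := by
  rw [abs_of_pos (hk.pos hmin h), one_mul]
  exact hk.le_exp hmin h

theorem abs_density_le (hk : IsKernel T lmin lmax H) (hmin : 0 < lmin) (hmax : lmin < lmax)
    (h : u ≤ t) : |density H t u| ≤ lmax * Real.exp (-lmin * (t - u)) := by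
  rw [abs_of_nonneg (hk.density_nonneg hmin h)]
  refine (hk.density_le hmin h).trans ?_
  have := hmin.trans hmax
  gcongr
  exact hk.le_exp hmin h

theorem aestronglyMeasurable_right (hk : IsKernel T lmin lmax H) (hmin : 0 < lmin) (t : ℝ) :
    AEStronglyMeasurable (H t) (volume.restrict (Iic t)) :=
  (hk.measurable_survKernel_right t).ennreal_toReal.aestronglyMeasurable.congr
    ((ae_restrict_mem measurableSet_Iic).mono fun _ hu => hk.toReal_survKernel hmin hu)

theorem aestronglyMeasurable_density (hk : IsKernel T lmin lmax H) (hmin : 0 < lmin) (t : ℝ) :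
    AEStronglyMeasurable (density H t) (volume.restrict (Iic t)) :=
  (hk.measurable_arrivalKernel_right t).ennreal_toReal.aestronglyMeasurable.congr
    ((ae_restrict_mem measurableSet_Iic).mono fun _ hu => hk.toReal_arrivalKernel hmin hu)

variable {ρ ρ' : ℝ → ℝ}

theorem integrableOn_mul (hk : IsKernel T lmin lmax H) (hT : 0 < T) (hmin : 0 < lmin)
    (hp : IsProfile T H ρ) (t : ℝ) : IntegrableOn (fun u => H t u * ρ u) (Iic t) :=
  hp.integrableOn_mul hT hmin (hk.aestronglyMeasurable_right hmin t)
    fun _ hu => hk.abs_survKernel_le hmin hu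

theorem integrableOn_density_mul (hk : IsKernel T lmin lmax H) (hT : 0 < T) (hmin : 0 < lmin)
    (hmax : lmin < lmax) (hp : IsProfile T H ρ) (t : ℝ) :
    IntegrableOn (fun u => density H t u * ρ u) (Iic t) :=
  hp.integrableOn_mul hT hmin (hk.aestronglyMeasurable_density hmin t)
    fun _ hu => hk.abs_density_le hmin hmax hu

/-- A solution is only assumed integrable over a period. The exponentially decaying density in its
own integral equation upgrades this to a uniform bound, the a priori input that uniqueness requires.
-/
theorem profile_bounded (hk : IsKernel T lmin lmax H) (hT : 0 < T) (hmin : 0 < lmin)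
    (hmax : lmin < lmax) (hp : IsProfile T H ρ) : ∃ B : ℝ≥0∞, B ≠ ∞ ∧ ∀ t, ‖ρ t‖ₑ ≤ B := by
  obtain ⟨B, hB, hle⟩ := hp.lintegral_exp_mul_enorm_le hT hmin
  refine ⟨ENNReal.ofReal lmax * B, ENNReal.mul_ne_top ENNReal.ofReal_ne_top hB, fun t => ?_⟩
  rw [hp.eq_integral t]
  refine (enorm_integral_le_lintegral_enorm _).trans ?_
  refine le_trans ?_ (mul_le_mul_right (hle t) (ENNReal.ofReal lmax))
  rw [← lintegral_const_mul' _ _ ENNReal.ofReal_ne_top]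
  refine setLIntegral_mono' measurableSet_Iic fun u hu => ?_
  rw [enorm_mul, ← mul_assoc, ← ENNReal.ofReal_mul' (Real.exp_pos _).le, Real.enorm_eq_ofReal_abs]
  gcongr
  exact hk.abs_density_le hmin hmax hu

/-- Subtracting `lmin` times the normalization shows that every solution satisfies `r = lmin + ∫ (K
- lmin * H) r`; the constant cancels in the difference. -/
theorem enorm_sub_le_lintegral (hk : IsKernel T lmin lmax H) (hT : 0 < T) (hmin : 0 < lmin)
    (hmax : lmin < lmax) (hp : IsProfile T H ρ) (hp' : IsProfile T H ρ') (t : ℝ) :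
    ‖ρ' t - ρ t‖ₑ ≤ ∫⁻ u, excessKernel lmin H t u * ‖ρ' u - ρ u‖ₑ := by
  have h : ∀ {r : ℝ → ℝ}, IsProfile T H r →
      IntegrableOn (fun u => density H t u * r u - lmin * (H t u * r u)) (Iic t) ∧
      r t - lmin = ∫ u in Iic t, (density H t u * r u - lmin * (H t u * r u)) := by
    intro r hr
    have h1 := hk.integrableOn_density_mul hT hmin hmax hr t
    have h2 := (hk.integrableOn_mul hT hmin hr t).const_mul lmin
    refine ⟨h1.sub h2, ?_⟩
    rw [integral_sub h1 h2, integral_const_mul, hr.normalized, ← hr.eq_integral, mul_one]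
  have h1 : ρ' t - ρ t = ∫ u in Iic t, (density H t u - lmin * H t u) * (ρ' u - ρ u) := by
    rw [← sub_sub_sub_cancel_right _ _ lmin, (h hp).2, (h hp').2,
      ← integral_sub (h hp').1 (h hp).1]
    refine integral_congr_ae (Eventually.of_forall fun u => ?_)
    ring
  rw [h1]
  refine (enorm_integral_le_lintegral_enorm _).trans ?_
  rw [← setLIntegral_Iic_eq_lintegral (t := t)
    fun u hu => by rw [excessKernel_of_not_le hu, zero_mul]]
  refine setLIntegral_mono' measurableSet_Iic fun u (hu : u ≤ t) => ?_
  rw [enorm_mul, excessKernel, if_pos hu,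
    Real.enorm_of_nonneg (sub_nonneg.2 (hk.le_density hmin hu))]

theorem lintegral_excessKernel_mul_profile_le (hk : IsKernel T lmin lmax H) (hmin : 0 < lmin)
    (hmax : lmin < lmax) (t : ℝ) :
    ∫⁻ u, excessKernel lmin H t u * profile lmin H u
      ≤ ENNReal.ofReal (1 - lmin / (2 * lmax)) * profile lmin H t := by
  refine le_trans (lintegral_mono fun u => ?_) (hk.lintegral_exp_rate_mul_excessKernel_le hmin hmax t)
  by_cases h : u ≤ t
  · refine le_mul_of_one_le_left zero_le (ENNReal.one_le_ofReal.2 (Real.one_le_exp ?_))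
    exact mul_nonneg (rate_pos hmin hmax).le (by linarith)
  · simp [excessKernel_of_not_le h]

theorem ofReal_contraction_lt_one (hmin : 0 < lmin) (hmax : lmin < lmax) :
    ENNReal.ofReal (1 - lmin / (2 * lmax)) < 1 := by
  have := hmin.trans hmax
  rw [ENNReal.ofReal_lt_one]
  linarith [show 0 < lmin / (2 * lmax) by positivity]

theorem profile_unique (hk : IsKernel T lmin lmax H) (hT : 0 < T) (hmin : 0 < lmin)
    (hmax : lmin < lmax) (hp : IsProfile T H ρ) :
    ρ = fun t => (profile lmin H t).toReal := by
  have hp0 := hk.isProfile_profile hmin hmax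
  obtain ⟨B, hB, hle⟩ := hk.profile_bounded hT hmin hmax hp
  obtain ⟨B', hB', hle'⟩ := hk.profile_bounded hT hmin hmax hp0
  have hl0 : ENNReal.ofReal lmin ≠ 0 := by simpa using hmin
  -- The constructed profile is the weight, and `A = 0` since the inequality for the difference has
  -- no source.
  have key := le_mul_of_contraction (μ := volume) (S := univ) MeasurableSet.univ
    (k := excessKernel lmin H) (d := fun u => ‖ρ u - (profile lmin H u).toReal‖ₑ)
    (w := profile lmin H) (A := 0) (M := (B + B') * (ENNReal.ofReal lmin)⁻¹) (by simp)
    (ENNReal.mul_ne_top (ENNReal.add_ne_top.2 ⟨hB, hB'⟩) (ENNReal.inv_ne_top.2 hl0))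
    (ofReal_contraction_lt_one hmin hmax) (fun t _ => hk.profile_ne_top hmin hmax t)
    (fun t _ => by
      simpa using hk.enorm_sub_le_lintegral hT hmin hmax hp0 hp t)
    (fun t _ => by
      simpa using hk.lintegral_excessKernel_mul_profile_le hmin hmax t)
    (fun t _ => by
      calc ‖ρ t - (profile lmin H t).toReal‖ₑ ≤ B + B' :=
            enorm_sub_le.trans (add_le_add (hle t) (hle' t))
        _ = (B + B') * (ENNReal.ofReal lmin)⁻¹ * ENNReal.ofReal lmin := by
            rw [mul_assoc, ENNReal.inv_mul_cancel hl0 ENNReal.ofReal_ne_top, mul_one]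
        _ ≤ _ := mul_le_mul_right (hk.le_profile t) _)
  funext t
  simpa [sub_eq_zero] using key t (mem_univ t)

/-! ### The stationary law of the age -/

theorem nuInf_apply (hk : IsKernel T lmin lmax H) (hmin : 0 < lmin) (hmax : lmin < lmax) (t : ℝ)
    {A : Set ℝ} (hA : MeasurableSet A) :
    nuInf H (fun t => (profile lmin H t).toReal) t A
      = ∫⁻ u in (fun u => t - u) ⁻¹' A, survKernel H t u * profile lmin H u := by
  rw [nuInf, withDensity_apply _ hA, Measure.restrict_restrict hA,
    ← lintegral_indicator (hA.inter measurableSet_Ici),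
    ← lintegral_indicator (hA.preimage (by fun_prop)), ← lintegral_sub_left_eq_self _ t]
  refine lintegral_congr fun u => ?_
  by_cases hu : u ≤ t
  · by_cases hA' : t - u ∈ A
    · simp [hu, hA', survKernel, ENNReal.ofReal_toReal (hk.profile_ne_top hmin hmax u),
        mul_comm (ENNReal.ofReal (H t u))]
    · simp [hA']
  · simp [indicator, hu, survKernel_of_not_le hu]

theorem isProbabilityMeasure_nuInf (hk : IsKernel T lmin lmax H) (hmin : 0 < lmin)
    (hmax : lmin < lmax) (t : ℝ) :
    IsProbabilityMeasure (nuInf H (fun t => (profile lmin H t).toReal) t) := by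
  refine ⟨?_⟩
  rw [hk.nuInf_apply hmin hmax t MeasurableSet.univ, preimage_univ, Measure.restrict_univ,
    hk.lintegral_survKernel_mul_profile hmin hmax]

end IsKernel

/-! ### Exponential convergence of a renewal density to the profile -/

theorem abs_toReal_sub_le {a b : ℝ≥0∞} {x : ℝ} (ha : a ≠ ∞) (hb : b ≠ ∞) (hx : 0 ≤ x)
    (h1 : a ≤ b + ENNReal.ofReal x) (h2 : b ≤ a + ENNReal.ofReal x) :
    |a.toReal - b.toReal| ≤ x := by
  have h : ∀ {a b : ℝ≥0∞}, b ≠ ∞ → a ≤ b + ENNReal.ofReal x → a.toReal ≤ b.toReal + x := by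
    intro a b hb h
    have := ENNReal.toReal_mono (ENNReal.add_ne_top.2 ⟨hb, ENNReal.ofReal_ne_top⟩) h
    rwa [ENNReal.toReal_add hb ENNReal.ofReal_ne_top, ENNReal.toReal_ofReal hx] at this
  have h3 := h hb h1
  have h4 := h ha h2
  rw [abs_le]
  constructor <;> linarith

/-- The constant in front of the exponential bound on the relative error of the renewal density. -/
noncomputable def amplitude (lmin lmax : ℝ) : ℝ := 2 * lmax ^ 2 / lmin ^ 2

theorem amplitude_pos (hmin : 0 < lmin) (hmax : lmin < lmax) : 0 < amplitude lmin lmax := by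
  have := hmin.trans hmax
  unfold amplitude
  positivity

theorem exp_neg_le_exp_neg_rate (hmin : 0 < lmin) (hmax : lmin < lmax) (hst : s ≤ t) :
    Real.exp (-lmin * (t - s)) ≤ Real.exp (-rate lmin lmax * (t - s)) := by
  refine Real.exp_le_exp.2 (mul_le_mul_of_nonneg_right ?_ (by linarith))
  linarith [rate_le hmin hmax]

/-- A solution of the renewal equation for a process started at time `s`. -/
structure IsRenewalDensity (lmin lmax : ℝ) (H : ℝ → ℝ → ℝ) (s : ℝ) (R : ℝ → ℝ≥0∞) : Prop where
  measurable : Measurable R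
  le : ∀ t, R t ≤ ENNReal.ofReal lmax
  eq_zero : ∀ t < s, R t = 0
  eq : ∀ t, s ≤ t →
    R t = ENNReal.ofReal lmin + excessKernel lmin H t s + ∫⁻ u, excessKernel lmin H t u * R u

namespace IsKernel

/-- Surviving from `u < s` to `t` means surviving to `s` and then decaying at rate at least `lmin`;
the mass at time `s` is at most one. -/
theorem setLIntegral_survKernel_mul_profile_le (hk : IsKernel T lmin lmax H) (hmin : 0 < lmin)
    (hmax : lmin < lmax) (hst : s ≤ t) :
    ∫⁻ u in Iio s, survKernel H t u * profile lmin H u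
      ≤ ENNReal.ofReal (Real.exp (-lmin * (t - s))) := by
  calc _ ≤ ∫⁻ u in Iio s, ENNReal.ofReal (Real.exp (-lmin * (t - s))) *
          (survKernel H s u * profile lmin H u) := by
        refine setLIntegral_mono' measurableSet_Iio fun u (hu : u < s) => ?_
        rw [← mul_assoc]
        exact mul_le_mul_left (hk.survKernel_le_exp_mul hmin hu.le hst) _
    _ ≤ ENNReal.ofReal (Real.exp (-lmin * (t - s))) * 1 := by
        rw [lintegral_const_mul' _ _ ENNReal.ofReal_ne_top,
          ← hk.lintegral_survKernel_mul_profile hmin hmax s]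
        gcongr
        exact Measure.restrict_le_self
    _ = _ := mul_one _

theorem setLIntegral_excessKernel_mul_profile_le (hk : IsKernel T lmin lmax H) (hmin : 0 < lmin)
    (hmax : lmin < lmax) (hst : s ≤ t) :
    ∫⁻ u in Iio s, excessKernel lmin H t u * profile lmin H u
      ≤ ENNReal.ofReal (lmax * Real.exp (-lmin * (t - s))) := by
  calc _ ≤ ∫⁻ u in Iio s, ENNReal.ofReal lmax * (survKernel H t u * profile lmin H u) := by
        refine lintegral_mono fun u => ?_
        rw [← mul_assoc]
        exact mul_le_mul_left (hk.excessKernel_le' hmin hmax t u) _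
    _ ≤ _ := by
        rw [lintegral_const_mul' _ _ ENNReal.ofReal_ne_top, ENNReal.ofReal_mul (hmin.trans hmax).le]
        gcongr
        exact hk.setLIntegral_survKernel_mul_profile_le hmin hmax hst

theorem excessKernel_le_exp (hk : IsKernel T lmin lmax H) (hmin : 0 < lmin)
    (hmax : lmin < lmax) (hst : s ≤ t) :
    excessKernel lmin H t s ≤ ENNReal.ofReal (lmax * Real.exp (-lmin * (t - s))) := by
  refine (hk.excessKernel_le' hmin hmax t s).trans ?_
  rw [ENNReal.ofReal_mul (hmin.trans hmax).le]
  gcongr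
  simpa [hst] using hk.survKernel_le_exp hmin t s

end IsKernel

namespace IsRenewalDensity

variable {R : ℝ → ℝ≥0∞}

/-- The pointwise distance of a renewal density and the profile. -/
noncomputable def gap (lmin : ℝ) (H : ℝ → ℝ → ℝ) (R : ℝ → ℝ≥0∞) (t : ℝ) : ℝ≥0∞ :=
  max (R t - profile lmin H t) (profile lmin H t - R t)

theorem le_add_gap (t : ℝ) : R t ≤ profile lmin H t + gap lmin H R t :=
  tsub_le_iff_left.1 (le_max_left _ _)

theorem profile_le_add_gap (t : ℝ) : profile lmin H t ≤ R t + gap lmin H R t :=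
  tsub_le_iff_left.1 (le_max_right _ _)

theorem setLIntegral_Icc_eq {k f : ℝ → ℝ≥0∞} {r : ℝ} (hk : ∀ u, ¬ u ≤ t → k u = 0)
    (htr : t ≤ r) : ∫⁻ u in Icc s r, k u * f u = ∫⁻ u in Ici s, k u * f u := by
  rw [← lintegral_indicator measurableSet_Icc, ← lintegral_indicator measurableSet_Ici]
  refine lintegral_congr fun u => ?_
  by_cases hs : s ≤ u
  · by_cases hu : u ≤ t
    · simp [hs, hu.trans htr]
    · simp [indicator, hk u hu]
  · simp [hs]

theorem setLIntegral_Ici_eq (hR : IsRenewalDensity lmin lmax H s R) (k : ℝ → ℝ≥0∞) :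
    ∫⁻ u in Ici s, k u * R u = ∫⁻ u, k u * R u := by
  rw [← lintegral_indicator measurableSet_Ici]
  refine lintegral_congr fun u => ?_
  by_cases hs : s ≤ u
  · simp [hs]
  · simp [hs, hR.eq_zero u (not_le.1 hs)]

/-- Both equations have source `lmin`. What remains is the excess of the initial arrival at `s` on
one side, and of stationary arrivals before `s` on the other. As only one of them enters each
one-sided difference, the error appears once. -/
theorem gap_le_add (hk : IsKernel T lmin lmax H) (hmin : 0 < lmin) (hmax : lmin < lmax)
    (hR : IsRenewalDensity lmin lmax H s R) (hst : s ≤ t) :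
    gap lmin H R t ≤ ENNReal.ofReal (lmax * Real.exp (-lmin * (t - s))) +
      ∫⁻ u in Ici s, excessKernel lmin H t u * gap lmin H R u := by
  have hm := hk.measurable_excessKernel_right lmin t
  refine max_le (tsub_le_iff_left.2 ?_) (tsub_le_iff_left.2 ?_)
  · calc R t = ENNReal.ofReal lmin + excessKernel lmin H t s
          + ∫⁻ u in Ici s, excessKernel lmin H t u * R u := by
          rw [hR.eq t hst, hR.setLIntegral_Ici_eq]
      _ ≤ ENNReal.ofReal lmin + excessKernel lmin H t s
          + ∫⁻ u in Ici s, (excessKernel lmin H t u * profile lmin H u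
            + excessKernel lmin H t u * gap lmin H R u) := by
          gcongr with u
          rw [← mul_add]
          gcongr
          exact le_add_gap u
      _ ≤ ENNReal.ofReal lmin + ENNReal.ofReal (lmax * Real.exp (-lmin * (t - s)))
          + ((∫⁻ u, excessKernel lmin H t u * profile lmin H u)
            + ∫⁻ u in Ici s, excessKernel lmin H t u * gap lmin H R u) := by
          rw [lintegral_add_left (hm.fun_mul (hk.measurable_profile _))]
          gcongr
          · exact hk.excessKernel_le_exp hmin hmax hst
          · exact Measure.restrict_le_self
      _ = _ := by rw [hk.profile_eq]; ring
  · calc profile lmin H t = ENNReal.ofReal lmin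
          + ((∫⁻ u in Ici s, excessKernel lmin H t u * profile lmin H u)
            + ∫⁻ u in Iio s, excessKernel lmin H t u * profile lmin H u) := by
          rw [hk.profile_eq, ← compl_Ici, lintegral_add_compl _ measurableSet_Ici]
      _ ≤ ENNReal.ofReal lmin
          + ((∫⁻ u in Ici s, (excessKernel lmin H t u * R u
            + excessKernel lmin H t u * gap lmin H R u))
            + ENNReal.ofReal (lmax * Real.exp (-lmin * (t - s)))) := by
          gcongr with u
          · rw [← mul_add]
            gcongr
            exact profile_le_add_gap u
          · exact hk.setLIntegral_excessKernel_mul_profile_le hmin hmax hst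
      _ ≤ (ENNReal.ofReal lmin + excessKernel lmin H t s)
          + (((∫⁻ u, excessKernel lmin H t u * R u)
            + ∫⁻ u in Ici s, excessKernel lmin H t u * gap lmin H R u)
            + ENNReal.ofReal (lmax * Real.exp (-lmin * (t - s)))) := by
          rw [lintegral_add_left (hm.fun_mul hR.measurable)]
          gcongr
          · exact le_self_add
          · exact Measure.restrict_le_self
      _ = _ := by rw [hR.eq t hst]; ring

theorem gap_le (hk : IsKernel T lmin lmax H) (hmin : 0 < lmin) (hmax : lmin < lmax)
    (hR : IsRenewalDensity lmin lmax H s R) (hst : s ≤ t) :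
    gap lmin H R t ≤ ENNReal.ofReal (amplitude lmin lmax * Real.exp (-rate lmin lmax * (t - s)))
      * profile lmin H t := by
  have hL := hmin.trans hmax
  set c := rate lmin lmax with hc
  have hc0 : 0 < c := rate_pos hmin hmax
  have hl0 : ENNReal.ofReal lmin ≠ 0 := by simpa using hmin
  set w : ℝ → ℝ≥0∞ := fun x => ENNReal.ofReal (Real.exp (-c * (x - s))) * profile lmin H x with hw
  -- The weight decays, so a finite a priori constant `M` is obtained by restricting to the window
  -- `[s, t]`; `M` depends on `t` but is absent from the conclusion. Dividing `A = lmax / lmin` by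
  -- `1 - q = lmin / (2 * lmax)` yields `amplitude`.
  have key := le_mul_of_contraction (μ := volume) (S := Icc s t) measurableSet_Icc
    (k := excessKernel lmin H) (d := gap lmin H R) (w := w) (A := ENNReal.ofReal (lmax / lmin))
    (M := ENNReal.ofReal (lmax / lmin * Real.exp (c * (t - s)))) ENNReal.ofReal_ne_top
    ENNReal.ofReal_ne_top (IsKernel.ofReal_contraction_lt_one hmin hmax)
    (fun x _ => ENNReal.mul_ne_top ENNReal.ofReal_ne_top (hk.profile_ne_top hmin hmax x))
    (fun x hx => ?_) (fun x hx => ?_) (fun x hx => ?_) t ⟨hst, le_rfl⟩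
  · refine key.trans (le_of_eq ?_)
    have hq : 1 - ENNReal.ofReal (1 - lmin / (2 * lmax)) = ENNReal.ofReal (lmin / (2 * lmax)) := by
      rw [← ENNReal.ofReal_one, ← ENNReal.ofReal_sub]
      · congr 1; ring
      · rw [sub_nonneg, div_le_one (by positivity)]
        linarith
    rw [hq, ← ENNReal.ofReal_inv_of_pos (by positivity), hw, ← mul_assoc,
      ← ENNReal.ofReal_mul (by positivity), ← ENNReal.ofReal_mul (by positivity), amplitude]
    congr 2
    field_simp
  · refine (hR.gap_le_add hk hmin hmax hx.1).trans ?_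
    rw [setLIntegral_Icc_eq (fun u hu => excessKernel_of_not_le hu) hx.2]
    gcongr
    calc ENNReal.ofReal (lmax * Real.exp (-lmin * (x - s)))
        ≤ ENNReal.ofReal (lmax / lmin) *
            (ENNReal.ofReal (Real.exp (-c * (x - s))) * ENNReal.ofReal lmin) := by
          rw [← ENNReal.ofReal_mul (by positivity), ← ENNReal.ofReal_mul (by positivity)]
          refine ENNReal.ofReal_le_ofReal ?_
          have := exp_neg_le_exp_neg_rate hmin hmax hx.1
          rw [show lmax / lmin * (Real.exp (-c * (x - s)) * lmin)
            = lmax * Real.exp (-c * (x - s)) by field_simp]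
          gcongr
      _ ≤ _ := by
          simp only [hw]
          gcongr
          exact hk.le_profile x
  · have h1 : ∀ u, excessKernel lmin H x u * w u = ENNReal.ofReal (Real.exp (-c * (x - s))) *
        (ENNReal.ofReal (Real.exp (c * (x - u))) *
          (excessKernel lmin H x u * profile lmin H u)) := by
      intro u
      rw [← mul_assoc (ENNReal.ofReal _) (ENNReal.ofReal _), ← ENNReal.ofReal_mul (by positivity),
        ← Real.exp_add, show -c * (x - s) + c * (x - u) = -c * (u - s) by ring, hw]
      ring
    simp only [h1]
    rw [lintegral_const_mul' _ _ ENNReal.ofReal_ne_top, hw, mul_left_comm]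
    gcongr
    exact (setLIntegral_le_lintegral _ _).trans
      (hk.lintegral_exp_rate_mul_excessKernel_le hmin hmax x)
  · calc gap lmin H R x ≤ ENNReal.ofReal lmax :=
          max_le (tsub_le_self.trans (hR.le x)) (tsub_le_self.trans (hk.profile_le hmin hmax x))
      _ ≤ ENNReal.ofReal (lmax / lmin * Real.exp (c * (t - s))) *
            (ENNReal.ofReal (Real.exp (-c * (x - s))) * ENNReal.ofReal lmin) := by
          rw [← ENNReal.ofReal_mul (by positivity), ← ENNReal.ofReal_mul (by positivity)]
          refine ENNReal.ofReal_le_ofReal ?_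
          rw [show lmax / lmin * Real.exp (c * (t - s)) * (Real.exp (-c * (x - s)) * lmin)
            = lmax * (Real.exp (c * (t - s)) * Real.exp (-c * (x - s))) by field_simp,
            ← Real.exp_add]
          refine le_mul_of_one_le_right hL.le (Real.one_le_exp ?_)
          have := hx.2
          nlinarith
      _ ≤ _ := by
          simp only [hw]
          gcongr
          exact hk.le_profile x

theorem gap_le_ofReal (hk : IsKernel T lmin lmax H) (hmin : 0 < lmin) (hmax : lmin < lmax)
    (hR : IsRenewalDensity lmin lmax H s R) (hst : s ≤ t) :
    gap lmin H R t ≤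
      ENNReal.ofReal (amplitude lmin lmax * lmax * Real.exp (-rate lmin lmax * (t - s))) := by
  refine (hR.gap_le hk hmin hmax hst).trans ?_
  refine (mul_le_mul_right (hk.profile_le hmin hmax t) _).trans (le_of_eq ?_)
  have := amplitude_pos hmin hmax
  rw [← ENNReal.ofReal_mul (by positivity)]
  ring_nf

/-- Since `gap_le` is relative to the profile, its factor `exp(-c (u-s))` can be written as `exp(-c
(t-s)) * exp(c (t-u))`, and the weighted stationary mass is at most `2`. -/
theorem lintegral_survKernel_mul_gap_le (hk : IsKernel T lmin lmax H) (hmin : 0 < lmin)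
    (hmax : lmin < lmax) (hR : IsRenewalDensity lmin lmax H s R) :
    ∫⁻ u in Ici s, survKernel H t u * gap lmin H R u ≤
      ENNReal.ofReal (2 * amplitude lmin lmax * Real.exp (-rate lmin lmax * (t - s))) := by
  have hA := amplitude_pos hmin hmax
  calc _ ≤ ∫⁻ u in Ici s,
          ENNReal.ofReal (amplitude lmin lmax * Real.exp (-rate lmin lmax * (t - s))) *
          (ENNReal.ofReal (Real.exp (rate lmin lmax * (t - u))) *
            (survKernel H t u * profile lmin H u)) := by
        refine setLIntegral_mono' measurableSet_Ici fun u hu => ?_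
        refine (mul_le_mul_right (hR.gap_le hk hmin hmax hu) _).trans (le_of_eq ?_)
        rw [← mul_assoc (ENNReal.ofReal _) (ENNReal.ofReal _), ← ENNReal.ofReal_mul (by positivity),
          mul_assoc (amplitude lmin lmax), ← Real.exp_add,
          show -rate lmin lmax * (t - s) + rate lmin lmax * (t - u)
            = -rate lmin lmax * (u - s) by ring]
        ring
    _ ≤ ENNReal.ofReal (amplitude lmin lmax * Real.exp (-rate lmin lmax * (t - s))) * 2 := by
        rw [lintegral_const_mul' _ _ ENNReal.ofReal_ne_top]
        gcongr
        exact (setLIntegral_le_lintegral _ _).trans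
          (hk.lintegral_exp_rate_mul_survKernel_le hmin hmax t)
    _ = _ := by
        rw [mul_comm, mul_assoc 2, ENNReal.ofReal_mul zero_le_two, ENNReal.ofReal_ofNat]

/-- The law of the last arrival before `t` and its stationary counterpart. -/
theorem setLIntegral_survKernel_le (hk : IsKernel T lmin lmax H) (hmin : 0 < lmin)
    (hmax : lmin < lmax) (hR : IsRenewalDensity lmin lmax H s R) (hst : s ≤ t) {A : Set ℝ}
    (hA : MeasurableSet A) :
    ∫⁻ u in A, survKernel H t u ∂(Measure.dirac s + volume.withDensity R) ≤
        (∫⁻ u in A, survKernel H t u * profile lmin H u) + ENNReal.ofReal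
          ((1 + 2 * amplitude lmin lmax) * Real.exp (-rate lmin lmax * (t - s))) ∧
      (∫⁻ u in A, survKernel H t u * profile lmin H u) ≤
        ∫⁻ u in A, survKernel H t u ∂(Measure.dirac s + volume.withDensity R) + ENNReal.ofReal
          ((1 + 2 * amplitude lmin lmax) * Real.exp (-rate lmin lmax * (t - s))) := by
  have hamp := amplitude_pos hmin hmax
  have hm := hk.measurable_survKernel_right t
  have hsplit : ENNReal.ofReal
      ((1 + 2 * amplitude lmin lmax) * Real.exp (-rate lmin lmax * (t - s)))
      = ENNReal.ofReal (Real.exp (-rate lmin lmax * (t - s))) + ENNReal.ofReal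
        (2 * amplitude lmin lmax * Real.exp (-rate lmin lmax * (t - s))) := by
    rw [← ENNReal.ofReal_add (by positivity) (by positivity)]
    ring_nf
  have hU : ∫⁻ u in A, survKernel H t u ∂(Measure.dirac s + volume.withDensity R)
      = (∫⁻ u in A, survKernel H t u ∂(Measure.dirac s)) + ∫⁻ u in A, survKernel H t u * R u := by
    rw [Measure.restrict_add, lintegral_add_measure, restrict_withDensity hA,
      lintegral_withDensity_eq_lintegral_mul _ hR.measurable hm]
    simp only [Pi.mul_apply, mul_comm (R _)]
  have hdirac : ∫⁻ u in A, survKernel H t u ∂(Measure.dirac s)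
      ≤ ENNReal.ofReal (Real.exp (-rate lmin lmax * (t - s))) := by
    refine (setLIntegral_le_lintegral _ _).trans ?_
    rw [lintegral_dirac' _ hm]
    refine (hk.survKernel_le_exp hmin t s).trans ?_
    simp only [indicator, mem_Iic, hst, if_true]
    exact ENNReal.ofReal_le_ofReal (exp_neg_le_exp_neg_rate hmin hmax hst)
  have hgap : ∫⁻ u in A ∩ Ici s, survKernel H t u * gap lmin H R u ≤
      ENNReal.ofReal (2 * amplitude lmin lmax * Real.exp (-rate lmin lmax * (t - s))) :=
    (lintegral_mono_set inter_subset_right).trans (hR.lintegral_survKernel_mul_gap_le hk hmin hmax)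
  have hRA : ∫⁻ u in A ∩ Ici s, survKernel H t u * R u = ∫⁻ u in A, survKernel H t u * R u := by
    rw [← lintegral_indicator (hA.inter measurableSet_Ici), ← lintegral_indicator hA]
    refine lintegral_congr fun u => ?_
    by_cases hs : s ≤ u
    · by_cases hu : u ∈ A <;> simp [hs, hu]
    · simp [indicator, hR.eq_zero u (not_le.1 hs)]
  rw [hU, hsplit]
  -- On `[s, ∞)` the gap costs the term with `2 * amplitude`. The additional `1` pays for the atom
  -- at `s` in the first direction and for the stationary mass before `s` in the second.
  constructor
  · calc _ ≤ ENNReal.ofReal (Real.exp (-rate lmin lmax * (t - s))) +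
            ∫⁻ u in A ∩ Ici s, (survKernel H t u * profile lmin H u
              + survKernel H t u * gap lmin H R u) := by
          rw [← hRA]
          gcongr with u
          rw [← mul_add]
          gcongr
          exact le_add_gap u
      _ ≤ ENNReal.ofReal (Real.exp (-rate lmin lmax * (t - s))) +
            ((∫⁻ u in A, survKernel H t u * profile lmin H u) + ENNReal.ofReal
              (2 * amplitude lmin lmax * Real.exp (-rate lmin lmax * (t - s)))) := by
          rw [lintegral_add_left (hm.fun_mul (hk.measurable_profile _))]
          gcongr
          exact inter_subset_left
      _ = _ := by ring
  · calc _ ≤ (∫⁻ u in A ∩ Ici s, survKernel H t u * profile lmin H u)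
            + ∫⁻ u in Iio s, survKernel H t u * profile lmin H u := by
          rw [← lintegral_inter_add_sdiff _ A measurableSet_Ici]
          gcongr
          intro u hu
          exact lt_of_not_ge (show ¬ s ≤ u from hu.2)
      _ ≤ (∫⁻ u in A ∩ Ici s, (survKernel H t u * R u + survKernel H t u * gap lmin H R u))
            + ENNReal.ofReal (Real.exp (-rate lmin lmax * (t - s))) := by
          gcongr with u
          · rw [← mul_add]
            gcongr
            exact profile_le_add_gap u
          · exact (hk.setLIntegral_survKernel_mul_profile_le hmin hmax hst).trans
              (ENNReal.ofReal_le_ofReal (exp_neg_le_exp_neg_rate hmin hmax hst))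
      _ ≤ ((∫⁻ u in A, survKernel H t u * R u) + ENNReal.ofReal
              (2 * amplitude lmin lmax * Real.exp (-rate lmin lmax * (t - s))))
            + ENNReal.ofReal (Real.exp (-rate lmin lmax * (t - s))) := by
          rw [lintegral_add_left (hm.fun_mul hR.measurable), hRA]
          gcongr
      _ ≤ _ := by
          rw [add_assoc, add_assoc, add_comm (ENNReal.ofReal (2 * _ * _))]
          exact le_add_self

end IsRenewalDensity

theorem setLIntegral_Ioi_exp {c : ℝ} (hc : 0 < c) {b : ℝ} (hb : 0 ≤ b) (s t : ℝ) :
    ∫⁻ u in Ioi t, ENNReal.ofReal (b * Real.exp (-c * (u - s)))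
      = ENNReal.ofReal (b / c * Real.exp (-c * (t - s))) := by
  have h : ∀ u, b * Real.exp (-c * (u - s)) = b * Real.exp (c * s) * Real.exp (-c * u) := by
    intro u
    rw [mul_assoc, ← Real.exp_add]
    ring_nf
  rw [← ofReal_integral_eq_lintegral_ofReal]
  · simp only [h]
    rw [integral_const_mul, integral_exp_mul_Ioi (by linarith)]
    congr 1
    rw [show -c * (t - s) = c * s + -c * t by ring, Real.exp_add]
    field_simp
  · simp only [h]
    exact (integrableOn_exp_mul_Ioi (by linarith) t).const_mul _
  · exact Eventually.of_forall fun u => mul_nonneg hb (Real.exp_pos _).le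

/-- The gap is integrable over the whole of `(t, ∞)`, which produces the factor `1 / rate` and a
bound independent of `r`. -/
theorem IsRenewalDensity.abs_setLIntegral_sub_le {R : ℝ → ℝ≥0∞} (hk : IsKernel T lmin lmax H)
    (hmin : 0 < lmin) (hmax : lmin < lmax) (hR : IsRenewalDensity lmin lmax H s R) (hst : s ≤ t)
    (r : ℝ) :
    |(∫⁻ u in Ioc t r, R u).toReal - (∫⁻ u in Ioc t r, profile lmin H u).toReal|
      ≤ amplitude lmin lmax * lmax / rate lmin lmax * Real.exp (-rate lmin lmax * (t - s)) := by
  have hamp := amplitude_pos hmin hmax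
  have hL := hmin.trans hmax
  have hc := rate_pos hmin hmax
  have hfin : ∀ f : ℝ → ℝ≥0∞, (∀ u, f u ≤ ENNReal.ofReal lmax) → ∫⁻ u in Ioc t r, f u ≠ ∞ := by
    intro f hf
    refine ne_top_of_le_ne_top ?_ (lintegral_mono hf)
    rw [setLIntegral_const, Real.volume_Ioc]
    exact ENNReal.mul_ne_top ENNReal.ofReal_ne_top ENNReal.ofReal_ne_top
  have hgap : ∫⁻ u in Ioc t r, gap lmin H R u ≤ ENNReal.ofReal
      (amplitude lmin lmax * lmax / rate lmin lmax * Real.exp (-rate lmin lmax * (t - s))) := by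
    rw [← setLIntegral_Ioi_exp hc (by positivity)]
    exact (lintegral_mono_set Ioc_subset_Ioi_self).trans (setLIntegral_mono' measurableSet_Ioi
      fun u (hu : t < u) => hR.gap_le_ofReal hk hmin hmax (hst.trans hu.le))
  refine abs_toReal_sub_le (hfin _ hR.le) (hfin _ (hk.profile_le hmin hmax)) (by positivity) ?_ ?_
  · refine (lintegral_mono fun u => le_add_gap (lmin := lmin) (H := H) u).trans ?_
    rw [lintegral_add_left (hk.measurable_profile _)]
    gcongr
  · refine (lintegral_mono fun u => profile_le_add_gap (R := R) u).trans ?_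
    rw [lintegral_add_left hR.measurable]
    gcongr

theorem IsKernel.intervalIntegral_profile (hk : IsKernel T lmin lmax H) (hmin : 0 < lmin)
    (hmax : lmin < lmax) {r : ℝ} (htr : t ≤ r) :
    ∫ u in t..r, (profile lmin H u).toReal = (∫⁻ u in Ioc t r, profile lmin H u).toReal := by
  rw [intervalIntegral.integral_of_le htr, integral_toReal (hk.measurable_profile _).aemeasurable
    (Eventually.of_forall fun u => (hk.profile_ne_top hmin hmax u).lt_top)]

theorem IsKernel.tendsto_survival_sub (hk : IsKernel T lmin lmax H) (hut : u ≤ t) :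
    Tendsto (fun h : ℝ => 1 / h * (survival H t u - survival H (t + h) u)) (𝓝[>] 0)
      (𝓝 (density H t u)) := by
  have h1 : HasDerivWithinAt (fun x => H x u) (-density H t u) (Ioi t) t :=
    (hk.hasDerivWithinAt hut).mono fun x (hx : t < x) => hut.trans hx.le
  have h2 := (hasDerivWithinAt_iff_tendsto_slope' self_notMem_Ioi).1 h1
  have h3 : Tendsto (fun h : ℝ => t + h) (𝓝[>] 0) (𝓝[>] t) := by
    refine tendsto_nhdsWithin_iff.2 ⟨?_, ?_⟩
    · have : Tendsto (fun h : ℝ => t + h) (𝓝 0) (𝓝 (t + 0)) := tendsto_id.const_add t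
      rw [add_zero] at this
      exact this.mono_left nhdsWithin_le_nhds
    · filter_upwards [self_mem_nhdsWithin] with h (hh : 0 < h)
      simpa using hh
  have h4 := (h2.comp h3).neg
  rw [neg_neg] at h4
  refine h4.congr' ?_
  filter_upwards [self_mem_nhdsWithin] with h (hh : 0 < h)
  simp only [Function.comp_def, slope, vsub_eq_sub, smul_eq_mul, survival, hut, if_true]
  rw [if_pos (by linarith), add_sub_cancel_left, one_div]
  ring

namespace IsKernel

theorem survival_nonneg (hk : IsKernel T lmin lmax H) (hmin : 0 < lmin) (t u : ℝ) :
    0 ≤ survival H t u := by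
  unfold survival
  split_ifs with h
  · exact (hk.pos hmin h).le
  · exact zero_le_one

theorem survival_le_one (hk : IsKernel T lmin lmax H) (hmin : 0 < lmin) (t u : ℝ) :
    survival H t u ≤ 1 := by
  unfold survival
  split_ifs with h
  · exact hk.le_one hmin h
  · exact le_rfl

theorem measurable_survival_right (hk : IsKernel T lmin lmax H) (t : ℝ) :
    Measurable (survival H t) :=
  hk.measurable.comp measurable_prodMk_left

theorem integrable_survival (hk : IsKernel T lmin lmax H) (hmin : 0 < lmin) (t : ℝ)
    (μ : Measure ℝ) [IsFiniteMeasure μ] : Integrable (survival H t) μ :=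
  Integrable.of_bound (hk.measurable_survival_right t).aestronglyMeasurable 1
    (Eventually.of_forall fun u => by
      rw [Real.norm_of_nonneg (hk.survival_nonneg hmin t u)]
      exact hk.survival_le_one hmin t u)

end IsKernel

/-! ### The renewal measure of an arrival sequence -/

/-- Boundedness and `τ 0 ω ≤ t` ensure that the supremum in `count` is attained; on an unbounded set
of naturals `sSup` is `0` by default. -/
theorem le_iff_le_count {Ω : Type*} {τ : ℕ → Ω → ℝ} {ω : Ω} (hmono : StrictMono fun k => τ k ω)
    (hb : BddAbove {k : ℕ | τ k ω ≤ t}) (h0 : τ 0 ω ≤ t) (k : ℕ) :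
    τ k ω ≤ t ↔ k ≤ count τ t ω := by
  have hmem : τ (count τ t ω) ω ≤ t := Nat.sSup_mem (s := {k : ℕ | τ k ω ≤ t}) ⟨0, h0⟩ hb
  exact ⟨fun h => le_csSup hb h, fun h => (hmono.monotone h).trans hmem⟩

variable {Ω : Type*} [MeasurableSpace Ω] {P : Measure Ω} {τ : ℕ → Ω → ℝ}

/-- The expected number of arrivals, as a measure on the line. -/
noncomputable def renewalMeasure (P : Measure Ω) (τ : ℕ → Ω → ℝ) : Measure ℝ :=
  Measure.sum fun k => P.map (τ k)

/-- The density of the renewal measure away from the starting time. -/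
noncomputable def renewalDensity (H : ℝ → ℝ → ℝ) (P : Measure Ω) (τ : ℕ → Ω → ℝ) (t : ℝ) : ℝ≥0∞ :=
  ∫⁻ u, arrivalKernel H t u ∂(renewalMeasure P τ)

namespace IsArrivalSequence

/-- The event that the interval `(t, r]` contains no arrival and that the last arrival before `t`
takes place at a time in `A`. -/
def lastIn (τ : ℕ → Ω → ℝ) (t r : ℝ) (A : Set ℝ) : Set Ω :=
  ⋃ k, τ k ⁻¹' (A ∩ Iic t) ∩ {ω | r < τ (k + 1) ω}

theorem measurableSet_lastIn (ha : IsArrivalSequence H s P τ) (t r : ℝ) {A : Set ℝ}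
    (hA : MeasurableSet A) : MeasurableSet (lastIn τ t r A) :=
  MeasurableSet.iUnion fun k => (ha.measurable k (hA.inter measurableSet_Iic)).inter
    (measurableSet_lt measurable_const (ha.measurable _))

theorem renewalMeasure_Iio (ha : IsArrivalSequence H s P τ) : renewalMeasure P τ (Iio s) = 0 := by
  rw [renewalMeasure, Measure.sum_apply _ measurableSet_Iio, ENNReal.tsum_eq_zero]
  intro k
  rw [Measure.map_apply (ha.measurable k) measurableSet_Iio]
  refine measure_mono_null ?_ (ae_iff.1 (ha.increasing.and ha.start))
  rintro ω (hω : τ k ω < s) ⟨hmono, h0⟩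
  have : τ 0 ω ≤ τ k ω := hmono.monotone k.zero_le
  linarith

theorem renewalDensity_eq_zero (ha : IsArrivalSequence H s P τ) (hts : t < s) :
    renewalDensity H P τ t = 0 := by
  rw [renewalDensity, ← lintegral_zero (μ := renewalMeasure P τ)]
  refine lintegral_congr_ae ?_
  have : ∀ᵐ u ∂(renewalMeasure P τ), ¬ u < s := by
    rw [ae_iff]
    simp only [not_not]
    exact ha.renewalMeasure_Iio
  filter_upwards [this] with u hu
  exact arrivalKernel_of_not_le fun h => hu (h.trans_lt hts)

theorem integral_density (hk : IsKernel T lmin lmax H) (hmin : 0 < lmin) (t : ℝ) :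
    ∫ u in Iic t, density H t u ∂(renewalMeasure P τ) = (renewalDensity H P τ t).toReal := by
  have h1 : ∫ u in Iic t, density H t u ∂(renewalMeasure P τ)
      = ∫ u in Iic t, (arrivalKernel H t u).toReal ∂(renewalMeasure P τ) :=
    setIntegral_congr_fun measurableSet_Iic fun u (hu : u ≤ t) =>
      (hk.toReal_arrivalKernel hmin hu).symm
  rw [h1, integral_toReal (hk.measurable_arrivalKernel_right t).aemeasurable
    (Eventually.of_forall fun u => (IsKernel.arrivalKernel_ne_top t u).lt_top), renewalDensity,
    ← lintegral_indicator measurableSet_Iic]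
  congr 1
  refine lintegral_congr fun u => ?_
  by_cases hu : u ≤ t
  · simp [hu]
  · simp [hu, arrivalKernel_of_not_le hu]

variable [IsProbabilityMeasure P]

theorem measure_preimage_inter (hk : IsKernel T lmin lmax H) (hmin : 0 < lmin)
    (ha : IsArrivalSequence H s P τ) (k : ℕ) (t : ℝ) {A : Set ℝ} (hA : MeasurableSet A) :
    P (τ k ⁻¹' A ∩ {ω | t < τ (k + 1) ω})
      = ∫⁻ u in A, ENNReal.ofReal (survival H t u) ∂(P.map (τ k)) := by
  have hE : MeasurableSet {ω | t < τ (k + 1) ω} :=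
    measurableSet_lt measurable_const (ha.measurable _)
  have hi : Integrable ({ω | t < τ (k + 1) ω}.indicator fun _ => (1 : ℝ)) P :=
    (integrable_const 1).indicator hE
  have h1 := setIntegral_condExp (ha.measurable k).comap_le hi (s := τ k ⁻¹' A) ⟨A, hA, rfl⟩
  rw [integral_congr_ae (ae_restrict_of_ae (ha.condLaw k t)), setIntegral_indicator hE,
    setIntegral_const, smul_eq_mul, mul_one] at h1
  have hint : Integrable (fun ω => survival H t (τ k ω)) (P.restrict (τ k ⁻¹' A)) :=
    Integrable.of_bound
      ((hk.measurable_survival_right t).comp (ha.measurable k)).aestronglyMeasurable 1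
      (Eventually.of_forall fun ω => by
        rw [Real.norm_of_nonneg (hk.survival_nonneg hmin t _)]
        exact hk.survival_le_one hmin t _)
  rw [setLIntegral_map hA (hk.measurable_survival_right t).ennreal_ofReal (ha.measurable k),
    ← ofReal_integral_eq_lintegral_ofReal hint
      (Eventually.of_forall fun ω => hk.survival_nonneg hmin t _), h1, ofReal_measureReal]

/-- Conditioning on `τ k` gives the tail of `τ (k + 1)`. Its complement to one is the integrated
density, so the two laws agree on all `Iic a`. -/
theorem map_succ (hk : IsKernel T lmin lmax H) (hmin : 0 < lmin)
    (ha : IsArrivalSequence H s P τ) (k : ℕ) :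
    P.map (τ (k + 1))
      = volume.withDensity fun x => ∫⁻ u, arrivalKernel H x u ∂(P.map (τ k)) := by
  have hp : ∀ j, IsProbabilityMeasure (P.map (τ j)) := fun j =>
    Measure.isProbabilityMeasure_map (ha.measurable j).aemeasurable
  have := hp k
  have := hp (k + 1)
  refine Measure.ext_of_Iic _ _ fun a => ?_
  have h1 : P.map (τ (k + 1)) (Ioi a)
      = ∫⁻ u, ENNReal.ofReal (survival H a u) ∂(P.map (τ k)) := by
    have := ha.measure_preimage_inter hk hmin k a MeasurableSet.univ
    rw [preimage_univ, univ_inter, Measure.restrict_univ] at this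
    rw [← this, Measure.map_apply (ha.measurable _) measurableSet_Ioi]
    rfl
  have h2 : ∫⁻ u, ENNReal.ofReal (survival H a u) ∂(P.map (τ k))
      + ∫⁻ x in Iic a, ∫⁻ u, arrivalKernel H x u ∂(P.map (τ k)) = 1 := by
    rw [lintegral_lintegral_swap hk.measurable_arrivalKernel.aemeasurable,
      ← lintegral_add_left (hk.measurable_survival_right a).ennreal_ofReal]
    simp only [hk.survival_add_lintegral hmin, lintegral_one, measure_univ]
  have h3 : P.map (τ (k + 1)) (Ioi a) + P.map (τ (k + 1)) (Iic a) = 1 := by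
    rw [← compl_Iic, add_comm, measure_add_measure_compl measurableSet_Iic, measure_univ]
  rw [withDensity_apply _ measurableSet_Iic]
  rw [← h1, ← h3] at h2
  exact ((ENNReal.add_right_inj (measure_ne_top _ _)).1 h2).symm

theorem map_zero (ha : IsArrivalSequence H s P τ) : P.map (τ 0) = Measure.dirac s := by
  rw [Measure.map_congr (g := fun _ => s) ha.start, Measure.map_const, measure_univ, one_smul]

theorem measurable_renewalDensity (hk : IsKernel T lmin lmax H) :
    Measurable (renewalDensity H P τ) := by
  have : SFinite (renewalMeasure P τ) := by unfold renewalMeasure; infer_instance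
  exact Measurable.lintegral_prod_right' hk.measurable_arrivalKernel

theorem renewalMeasure_eq (hk : IsKernel T lmin lmax H) (hmin : 0 < lmin)
    (ha : IsArrivalSequence H s P τ) :
    renewalMeasure P τ = Measure.dirac s + volume.withDensity (renewalDensity H P τ) := by
  have h1 : renewalDensity H P τ = ∑' k : ℕ, fun x => ∫⁻ u, arrivalKernel H x u ∂(P.map (τ k)) := by
    funext x
    rw [ENNReal.tsum_apply, renewalDensity, renewalMeasure, lintegral_sum_measure]
  have h2 : ∀ k : ℕ, Measurable fun x => ∫⁻ u, arrivalKernel H x u ∂(P.map (τ k)) := fun k =>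
    Measurable.lintegral_prod_right' hk.measurable_arrivalKernel
  rw [h1, withDensity_tsum h2]
  refine Measure.ext fun A hA => ?_
  rw [Measure.add_apply, Measure.sum_apply _ hA, renewalMeasure, Measure.sum_apply _ hA,
    tsum_eq_zero_add' ENNReal.summable, ha.map_zero]
  simp only [ha.map_succ hk hmin]

/-- The integral is a sum over `k` of the probabilities that `τ k` is the last arrival; strict
monotonicity makes these events almost surely disjoint. -/
theorem lintegral_survival_renewalMeasure (hk : IsKernel T lmin lmax H) (hmin : 0 < lmin)
    (ha : IsArrivalSequence H s P τ) {r : ℝ} (htr : t ≤ r) {A : Set ℝ} (hA : MeasurableSet A) :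
    ∫⁻ u in A ∩ Iic t, ENNReal.ofReal (survival H r u) ∂(renewalMeasure P τ)
      = P (lastIn τ t r A) := by
  have hA' := hA.inter (measurableSet_Iic (a := t))
  rw [renewalMeasure, Measure.restrict_sum _ hA', lintegral_sum_measure, lastIn, measure_iUnion₀]
  · exact tsum_congr fun k => (ha.measure_preimage_inter hk hmin k r hA').symm
  · intro i j hij
    refine measure_mono_null ?_ (ae_iff.1 ha.increasing)
    rintro ω ⟨⟨hi, hi'⟩, ⟨hj, hj'⟩⟩ hmono
    have h1 := hi.2
    have h2 := hj.2
    simp only [mem_ofPred_eq, mem_Iic] at h1 h2 hi' hj'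
    rcases lt_or_gt_of_ne hij with h | h
    · have : τ (i + 1) ω ≤ τ j ω := hmono.monotone h
      linarith
    · have : τ (j + 1) ω ≤ τ i ω := hmono.monotone h
      linarith
  · exact fun k => ((ha.measurable k hA').inter
      (measurableSet_lt measurable_const (ha.measurable _))).nullMeasurableSet

theorem setLIntegral_survKernel_renewalMeasure (hk : IsKernel T lmin lmax H) (hmin : 0 < lmin)
    (ha : IsArrivalSequence H s P τ) (t : ℝ) {A : Set ℝ} (hA : MeasurableSet A) :
    ∫⁻ u in A, survKernel H t u ∂(renewalMeasure P τ) = P (lastIn τ t t A) := by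
  rw [← ha.lintegral_survival_renewalMeasure hk hmin le_rfl hA,
    ← lintegral_indicator hA, ← lintegral_indicator (hA.inter measurableSet_Iic)]
  refine lintegral_congr fun u => ?_
  by_cases hu : u ≤ t <;> by_cases huA : u ∈ A <;> simp [hu, huA, survKernel, survival]

/-- At this stage only "at most one last arrival" is available. That already bounds the renewal
density by `lmax`, which will rule out accumulation of arrivals. -/
theorem lintegral_survKernel_le_one (hk : IsKernel T lmin lmax H) (hmin : 0 < lmin)
    (ha : IsArrivalSequence H s P τ) (t : ℝ) :
    ∫⁻ u, survKernel H t u ∂(renewalMeasure P τ) ≤ 1 := by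
  rw [← setLIntegral_univ, ha.setLIntegral_survKernel_renewalMeasure hk hmin t MeasurableSet.univ]
  exact prob_le_one

theorem renewalDensity_le (hk : IsKernel T lmin lmax H) (hmin : 0 < lmin) (hmax : lmin < lmax)
    (ha : IsArrivalSequence H s P τ) (t : ℝ) : renewalDensity H P τ t ≤ ENNReal.ofReal lmax := by
  calc renewalDensity H P τ t
      ≤ ∫⁻ u, ENNReal.ofReal lmax * survKernel H t u ∂(renewalMeasure P τ) :=
        lintegral_mono fun u => hk.arrivalKernel_le hmin hmax t u
    _ ≤ ENNReal.ofReal lmax * 1 := by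
        rw [lintegral_const_mul' _ _ ENNReal.ofReal_ne_top]
        gcongr
        exact ha.lintegral_survKernel_le_one hk hmin t
    _ = _ := mul_one _

theorem renewalMeasure_Iic_lt_top (hk : IsKernel T lmin lmax H) (hmin : 0 < lmin)
    (hmax : lmin < lmax) (ha : IsArrivalSequence H s P τ) (t : ℝ) :
    renewalMeasure P τ (Iic t) < ∞ := by
  have h1 : Iic t ⊆ Iio s ∪ Icc s t := fun u (hu : u ≤ t) =>
    (lt_or_ge u s).imp id fun h => ⟨h, hu⟩
  refine (measure_mono h1).trans_lt ((measure_union_le _ _).trans_lt ?_)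
  rw [ha.renewalMeasure_Iio, zero_add, ha.renewalMeasure_eq hk hmin, Measure.add_apply,
    withDensity_apply _ measurableSet_Icc]
  refine ENNReal.add_lt_top.2 ⟨measure_lt_top _ _, ?_⟩
  refine (lintegral_mono fun u => ha.renewalDensity_le hk hmin hmax u).trans_lt ?_
  rw [setLIntegral_const, Real.volume_Icc]
  exact ENNReal.mul_lt_top ENNReal.ofReal_lt_top ENNReal.ofReal_lt_top

/-! ### Finiteness of the count and law of the age -/

/-- Borel–Cantelli: the sum of `P (τ k ≤ t)` is the renewal measure of `Iic t`, which is finite. -/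
theorem ae_bddAbove (hk : IsKernel T lmin lmax H) (hmin : 0 < lmin)
    (hmax : lmin < lmax) (ha : IsArrivalSequence H s P τ) (t : ℝ) :
    ∀ᵐ ω ∂P, BddAbove {k : ℕ | τ k ω ≤ t} := by
  have h1 : ∑' k, P {ω | τ k ω ≤ t} ≠ ∞ := by
    have := (ha.renewalMeasure_Iic_lt_top hk hmin hmax t).ne
    rw [renewalMeasure, Measure.sum_apply _ measurableSet_Iic] at this
    simpa only [Measure.map_apply (ha.measurable _) measurableSet_Iic] using! this
  filter_upwards [ae_eventually_notMem h1] with ω hω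
  obtain ⟨n, hn⟩ := eventually_atTop.1 hω
  exact ⟨n, fun k hk => le_of_not_ge fun hnk => hn k hnk hk⟩

theorem ae_le_iff_le_count (hk : IsKernel T lmin lmax H) (hmin : 0 < lmin)
    (hmax : lmin < lmax) (ha : IsArrivalSequence H s P τ) (hst : s ≤ t) :
    ∀ᵐ ω ∂P, ∀ k, τ k ω ≤ t ↔ k ≤ count τ t ω := by
  filter_upwards [ha.increasing, ha.start, ha.ae_bddAbove hk hmin hmax t] with ω h1 h2 h3
  exact le_iff_le_count h1 h3 (h2.le.trans hst)

theorem ae_mem_lastIn_iff (hk : IsKernel T lmin lmax H) (hmin : 0 < lmin)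
    (hmax : lmin < lmax) (ha : IsArrivalSequence H s P τ) (hst : s ≤ t) {r : ℝ} (htr : t ≤ r)
    (A : Set ℝ) : ∀ᵐ ω ∂P, ω ∈ lastIn τ t r A ↔
      τ (count τ t ω) ω ∈ A ∧ count τ r ω = count τ t ω := by
  filter_upwards [ha.ae_le_iff_le_count hk hmin hmax hst,
    ha.ae_le_iff_le_count hk hmin hmax (hst.trans htr)] with ω h1 h2
  have hle : count τ t ω ≤ count τ r ω := (h2 _).1 (((h1 _).2 le_rfl).trans htr)
  simp only [lastIn, mem_iUnion, mem_inter_iff, mem_preimage, mem_Iic, mem_ofPred_eq, ← not_le, h1,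
    h2]
  constructor
  · rintro ⟨k, ⟨hA, hk1⟩, hk2⟩
    have h3 : k = count τ t ω := by omega
    subst h3
    exact ⟨hA, by omega⟩
  · rintro ⟨hA, h⟩
    exact ⟨count τ t ω, ⟨hA, le_rfl⟩, by omega⟩

theorem age_preimage_ae_eq (hk : IsKernel T lmin lmax H) (hmin : 0 < lmin)
    (hmax : lmin < lmax) (ha : IsArrivalSequence H s P τ) (hst : s ≤ t) (A : Set ℝ) :
    (age τ t ⁻¹' A : Set Ω) =ᵐ[P] lastIn τ t t ((fun u => t - u) ⁻¹' A) := by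
  filter_upwards [ha.ae_mem_lastIn_iff hk hmin hmax hst le_rfl ((fun u => t - u) ⁻¹' A)] with ω h
  refine propext (Iff.symm (h.trans ?_))
  simp only [and_true]
  rfl

/-- Preimages under `age` agree almost everywhere with the measurable events `lastIn`. -/
theorem aemeasurable_age (hk : IsKernel T lmin lmax H) (hmin : 0 < lmin)
    (hmax : lmin < lmax) (ha : IsArrivalSequence H s P τ) (hst : s ≤ t) :
    AEMeasurable (age τ t) P :=
  NullMeasurable.aemeasurable fun A hA =>
    (ha.measurableSet_lastIn t t (hA.preimage (by fun_prop))).nullMeasurableSet.congr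
      (ha.age_preimage_ae_eq hk hmin hmax hst A).symm

theorem map_age_apply (hk : IsKernel T lmin lmax H) (hmin : 0 < lmin)
    (hmax : lmin < lmax) (ha : IsArrivalSequence H s P τ) (hst : s ≤ t) {A : Set ℝ}
    (hA : MeasurableSet A) :
    P.map (age τ t) A = ∫⁻ u in (fun u => t - u) ⁻¹' A, survKernel H t u ∂(renewalMeasure P τ) := by
  rw [Measure.map_apply_of_aemeasurable (ha.aemeasurable_age hk hmin hmax hst) hA,
    measure_congr (ha.age_preimage_ae_eq hk hmin hmax hst A),
    ha.setLIntegral_survKernel_renewalMeasure hk hmin t (hA.preimage (by fun_prop))]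

/-- The left side is the total mass of the law of the age. This exact normalization turns `lmin * H`
into the constant source `lmin` of the renewal equation. -/
theorem lintegral_survKernel_eq_one (hk : IsKernel T lmin lmax H) (hmin : 0 < lmin)
    (hmax : lmin < lmax) (ha : IsArrivalSequence H s P τ) (hst : s ≤ t) :
    ∫⁻ u, survKernel H t u ∂(renewalMeasure P τ) = 1 := by
  have h := ha.map_age_apply hk hmin hmax hst MeasurableSet.univ
  rw [preimage_univ, setLIntegral_univ] at h
  have := Measure.isProbabilityMeasure_map (ha.aemeasurable_age hk hmin hmax hst)
  rw [← h, measure_univ]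

theorem isRenewalDensity (hk : IsKernel T lmin lmax H) (hmin : 0 < lmin) (hmax : lmin < lmax)
    (ha : IsArrivalSequence H s P τ) :
    IsRenewalDensity lmin lmax H s (renewalDensity H P τ) where
  measurable := measurable_renewalDensity hk
  le := ha.renewalDensity_le hk hmin hmax
  eq_zero := fun _ ht => ha.renewalDensity_eq_zero ht
  eq := fun t hst => by
    have hm := hk.measurable_excessKernel_right lmin t
    have h1 : ∫⁻ u, excessKernel lmin H t u ∂(renewalMeasure P τ)
        = excessKernel lmin H t s + ∫⁻ u, excessKernel lmin H t u * renewalDensity H P τ u := by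
      rw [ha.renewalMeasure_eq hk hmin, lintegral_add_measure, lintegral_dirac' _ hm,
        lintegral_withDensity_eq_lintegral_mul _ (measurable_renewalDensity hk) hm]
      simp only [Pi.mul_apply, mul_comm]
    rw [renewalDensity]
    simp only [hk.arrivalKernel_eq hmin]
    rw [lintegral_add_left hm, lintegral_const_mul' _ _ ENNReal.ofReal_ne_top,
      ha.lintegral_survKernel_eq_one hk hmin hmax hst, h1]
    ring

/-! ### The age, the intensity and the expected increments -/

theorem tvDist_le (hk : IsKernel T lmin lmax H) (hmin : 0 < lmin) (hmax : lmin < lmax)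
    (ha : IsArrivalSequence H s P τ) (hst : s ≤ t) :
    tvDist (P.map (age τ t)) (nuInf H (fun t => (profile lmin H t).toReal) t)
      ≤ (1 + 2 * amplitude lmin lmax) * Real.exp (-rate lmin lmax * (t - s)) := by
  have hamp := amplitude_pos hmin hmax
  have := Measure.isProbabilityMeasure_map (ha.aemeasurable_age hk hmin hmax hst)
  have := hk.isProbabilityMeasure_nuInf hmin hmax t
  refine Real.iSup_le (fun A => ?_) (by positivity)
  have h := (ha.isRenewalDensity hk hmin hmax).setLIntegral_survKernel_le hk hmin hmax hst
    (A.2.preimage (f := fun u => t - u) (by fun_prop))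
  rw [← ha.renewalMeasure_eq hk hmin, ← ha.map_age_apply hk hmin hmax hst A.2,
    ← hk.nuInf_apply hmin hmax t A.2] at h
  exact abs_toReal_sub_le (measure_ne_top _ _) (measure_ne_top _ _) (by positivity) h.1 h.2

theorem real_lastIn (hk : IsKernel T lmin lmax H) (hmin : 0 < lmin) (hmax : lmin < lmax)
    (ha : IsArrivalSequence H s P τ) {r : ℝ} (htr : t ≤ r) :
    P.real (lastIn τ t r univ) = ∫ u in Iic t, survival H r u ∂(renewalMeasure P τ) := by
  have : IsFiniteMeasure ((renewalMeasure P τ).restrict (Iic t)) :=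
    ⟨by simpa using ha.renewalMeasure_Iic_lt_top hk hmin hmax t⟩
  have h := ha.lintegral_survival_renewalMeasure hk hmin htr MeasurableSet.univ
  rw [univ_inter, ← ofReal_integral_eq_lintegral_ofReal (hk.integrable_survival hmin r _)
    (Eventually.of_forall fun u => hk.survival_nonneg hmin r u)] at h
  rw [Measure.real, ← h, ENNReal.toReal_ofReal (integral_nonneg fun u => hk.survival_nonneg hmin r u)]

theorem real_count_sub_pos (hk : IsKernel T lmin lmax H) (hmin : 0 < lmin) (hmax : lmin < lmax)
    (ha : IsArrivalSequence H s P τ) (hst : s ≤ t) {h : ℝ} (hh : 0 ≤ h) :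
    P.real {ω | 0 < (count τ (t + h) ω : ℝ) - (count τ t ω : ℝ)}
      = ∫ u in Iic t, (survival H t u - survival H (t + h) u) ∂(renewalMeasure P τ) := by
  have : IsFiniteMeasure ((renewalMeasure P τ).restrict (Iic t)) :=
    ⟨by simpa using ha.renewalMeasure_Iic_lt_top hk hmin hmax t⟩
  have hth : t ≤ t + h := by linarith
  have h1 : ({ω | 0 < (count τ (t + h) ω : ℝ) - (count τ t ω : ℝ)} : Set Ω)
      =ᵐ[P] ((lastIn τ t (t + h) univ)ᶜ : Set Ω) := by
    filter_upwards [ha.ae_mem_lastIn_iff hk hmin hmax hst hth univ,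
      ha.ae_le_iff_le_count hk hmin hmax hst,
      ha.ae_le_iff_le_count hk hmin hmax (hst.trans hth)] with ω h1 h2 h3
    have hle : count τ t ω ≤ count τ (t + h) ω := (h3 _).1 (((h2 _).2 le_rfl).trans hth)
    refine propext ?_
    change 0 < (count τ (t + h) ω : ℝ) - (count τ t ω : ℝ) ↔ ¬ ω ∈ lastIn τ t (t + h) univ
    rw [h1, sub_pos, Nat.cast_lt]
    simp only [mem_univ, true_and]
    omega
  have h2 : P.real (lastIn τ t t univ) = 1 := by
    rw [Measure.real, ← ha.setLIntegral_survKernel_renewalMeasure hk hmin t MeasurableSet.univ,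
      setLIntegral_univ, ha.lintegral_survKernel_eq_one hk hmin hmax hst, ENNReal.toReal_one]
  rw [measureReal_congr h1, probReal_compl_eq_one_sub
    (ha.measurableSet_lastIn t (t + h) MeasurableSet.univ), ← h2,
    ha.real_lastIn hk hmin hmax hth, ha.real_lastIn hk hmin hmax le_rfl,
    integral_sub (hk.integrable_survival hmin _ _) (hk.integrable_survival hmin _ _)]

/-- Dominated convergence of difference quotients of `H`: they are bounded by `lmax`, and the
renewal measure is finite on `Iic t`. -/
theorem tendsto_real_count_sub_pos (hk : IsKernel T lmin lmax H) (hmin : 0 < lmin)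
    (hmax : lmin < lmax) (ha : IsArrivalSequence H s P τ) (hst : s ≤ t) :
    Tendsto (fun h : ℝ => 1 / h * P.real
      {ω | 0 < (count τ (t + h) ω : ℝ) - (count τ t ω : ℝ)}) (𝓝[>] 0)
      (𝓝 (renewalDensity H P τ t).toReal) := by
  have : IsFiniteMeasure ((renewalMeasure P τ).restrict (Iic t)) :=
    ⟨by simpa using ha.renewalMeasure_Iic_lt_top hk hmin hmax t⟩
  rw [← integral_density hk hmin]
  have key : Tendsto (fun h : ℝ => ∫ u in Iic t,
      1 / h * (survival H t u - survival H (t + h) u) ∂(renewalMeasure P τ)) (𝓝[>] 0)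
      (𝓝 (∫ u in Iic t, density H t u ∂(renewalMeasure P τ))) := by
    refine tendsto_integral_filter_of_dominated_convergence (fun _ => lmax)
      (Eventually.of_forall fun h => ?_) ?_ (integrable_const _) ?_
    · exact (((hk.measurable_survival_right t).sub
        (hk.measurable_survival_right (t + h))).const_mul _).aestronglyMeasurable
    · filter_upwards [self_mem_nhdsWithin] with h (hh : 0 < h)
      refine (ae_restrict_mem measurableSet_Iic).mono fun u (hu : u ≤ t) => ?_
      have hth : t ≤ t + h := by linarith
      have h1 := hk.sub_le hmin hmax hu hth
      have h2 := hk.antitone hmin hu hth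
      simp only [survival, hu, hu.trans hth, if_true]
      rw [Real.norm_of_nonneg (mul_nonneg (by positivity) (by linarith)), one_div,
        inv_mul_le_iff₀ hh]
      linarith
    · exact (ae_restrict_mem measurableSet_Iic).mono fun u hu => hk.tendsto_survival_sub hu
  refine key.congr' ?_
  filter_upwards [self_mem_nhdsWithin] with h (hh : 0 < h)
  rw [ha.real_count_sub_pos hk hmin hmax hst hh.le, integral_const_mul]

theorem ae_count_sub_eq (hk : IsKernel T lmin lmax H) (hmin : 0 < lmin)
    (hmax : lmin < lmax) (ha : IsArrivalSequence H s P τ) (hst : s ≤ t) {r : ℝ} (htr : t ≤ r) :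
    (fun ω => (∑' k, (τ k ⁻¹' Ioc t r).indicator (fun _ => (1 : ℝ≥0∞)) ω).toReal)
      =ᵐ[P] fun ω => (count τ r ω : ℝ) - (count τ t ω : ℝ) := by
  filter_upwards [ha.ae_le_iff_le_count hk hmin hmax hst,
    ha.ae_le_iff_le_count hk hmin hmax (hst.trans htr)] with ω h1 h2
  have hle : count τ t ω ≤ count τ r ω := (h2 _).1 (((h1 _).2 le_rfl).trans htr)
  have hmem : ∀ k, ω ∈ τ k ⁻¹' Ioc t r ↔ k ∈ Finset.Ioc (count τ t ω) (count τ r ω) := by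
    intro k
    rw [mem_preimage, mem_Ioc, Finset.mem_Ioc, h2, ← not_le, h1, not_le]
  rw [tsum_eq_sum (s := Finset.Ioc (count τ t ω) (count τ r ω)) fun k hk' =>
    indicator_of_notMem (fun hω => hk' ((hmem k).1 hω)) _,
    Finset.sum_congr rfl fun k hk' => indicator_of_mem ((hmem k).2 hk') _]
  simp only [Finset.sum_const, Nat.card_Ioc, nsmul_eq_mul, mul_one, ENNReal.toReal_natCast]
  rw [Nat.cast_sub hle]

theorem lintegral_tsum_indicator (hk : IsKernel T lmin lmax H) (hmin : 0 < lmin)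
    (ha : IsArrivalSequence H s P τ) (hst : s ≤ t) (r : ℝ) :
    ∫⁻ ω, ∑' k, (τ k ⁻¹' Ioc t r).indicator (fun _ => (1 : ℝ≥0∞)) ω ∂P
      = ∫⁻ u in Ioc t r, renewalDensity H P τ u := by
  have hm : ∀ k, MeasurableSet (τ k ⁻¹' Ioc t r) := fun k => ha.measurable k measurableSet_Ioc
  rw [lintegral_tsum fun k => (measurable_const.indicator (hm k)).aemeasurable]
  have h1 : ∀ k, ∫⁻ ω, (τ k ⁻¹' Ioc t r).indicator (fun _ => (1 : ℝ≥0∞)) ω ∂P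
      = P.map (τ k) (Ioc t r) := fun k => by
    rw [lintegral_indicator (hm k), setLIntegral_one,
      Measure.map_apply (ha.measurable k) measurableSet_Ioc]
  simp only [h1]
  -- The atom at `s` does not contribute: `s ≤ t`, and the interval is open at `t`.
  rw [← Measure.sum_apply _ measurableSet_Ioc, ← renewalMeasure, ha.renewalMeasure_eq hk hmin,
    Measure.add_apply, withDensity_apply _ measurableSet_Ioc,
    Measure.dirac_apply' _ measurableSet_Ioc, indicator_of_notMem (fun h => not_le.2 h.1 hst),
    zero_add]

theorem integral_count_sub (hk : IsKernel T lmin lmax H) (hmin : 0 < lmin)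
    (hmax : lmin < lmax) (ha : IsArrivalSequence H s P τ) (hst : s ≤ t) {r : ℝ} (htr : t ≤ r) :
    Integrable (fun ω => (count τ r ω : ℝ) - (count τ t ω : ℝ)) P ∧
      ∫ ω, ((count τ r ω : ℝ) - (count τ t ω : ℝ)) ∂P
        = (∫⁻ u in Ioc t r, renewalDensity H P τ u).toReal := by
  have hm : Measurable fun ω => ∑' k, (τ k ⁻¹' Ioc t r).indicator (fun _ => (1 : ℝ≥0∞)) ω :=
    Measurable.tsum fun k => measurable_const.indicator (ha.measurable k measurableSet_Ioc)
  have hfin : ∫⁻ ω, ∑' k, (τ k ⁻¹' Ioc t r).indicator (fun _ => (1 : ℝ≥0∞)) ω ∂P ≠ ∞ := by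
    rw [ha.lintegral_tsum_indicator hk hmin hst]
    refine ne_top_of_le_ne_top ?_
      (lintegral_mono fun u => ha.renewalDensity_le hk hmin hmax u)
    rw [setLIntegral_const, Real.volume_Ioc]
    exact ENNReal.mul_ne_top ENNReal.ofReal_ne_top ENNReal.ofReal_ne_top
  have hae := ha.ae_count_sub_eq hk hmin hmax hst htr
  refine ⟨(integrable_toReal_of_lintegral_ne_top hm.aemeasurable hfin).congr hae, ?_⟩
  rw [← integral_congr_ae hae, integral_toReal hm.aemeasurable (ae_lt_top hm hfin),
    ha.lintegral_tsum_indicator hk hmin hst]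

end IsArrivalSequence

end PeriodicRenewal

theorem theorem1 (T lmin lmax : ℝ) (hT : 0 < T) (hmin : 0 < lmin) (hmax : lmin < lmax) :
    ∃ C c : ℝ, 0 < C ∧ 0 < c ∧
      ∀ H : ℝ → ℝ → ℝ, PeriodicRenewal.IsKernel T lmin lmax H →
        ∃ ρ : ℝ → ℝ, PeriodicRenewal.IsProfile T H ρ ∧
          (∀ ρ' : ℝ → ℝ, PeriodicRenewal.IsProfile T H ρ' → ρ' = ρ) ∧
          (∀ t : ℝ, IsProbabilityMeasure (PeriodicRenewal.nuInf H ρ t)) ∧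
          ∀ (Ω : Type*) [MeasurableSpace Ω] (P : Measure Ω) [IsProbabilityMeasure P]
            (s : ℝ) (τ : ℕ → Ω → ℝ), PeriodicRenewal.IsArrivalSequence H s P τ →
            ∀ t : ℝ, s ≤ t →
              (∀ᵐ ω ∂P, BddAbove {k : ℕ | τ k ω ≤ t}) ∧
              AEMeasurable (PeriodicRenewal.age τ t) P ∧
              PeriodicRenewal.tvDist (P.map (PeriodicRenewal.age τ t))
                  (PeriodicRenewal.nuInf H ρ t) ≤ C * Real.exp (-c * (t - s)) ∧
              (∃ r : ℝ,
                Tendsto (fun h : ℝ => 1 / h * P.real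
                    {ω | 0 < (PeriodicRenewal.count τ (t + h) ω : ℝ)
                      - (PeriodicRenewal.count τ t ω : ℝ)}) (𝓝[>] 0) (𝓝 r) ∧
                |r - ρ t| ≤ C * lmax * Real.exp (-c * (t - s))) ∧
              ∀ a : ℝ, 0 < a →
                Integrable (fun ω => (PeriodicRenewal.count τ (t + a) ω : ℝ)
                  - (PeriodicRenewal.count τ t ω : ℝ)) P ∧
                |(∫ ω, ((PeriodicRenewal.count τ (t + a) ω : ℝ)
                    - (PeriodicRenewal.count τ t ω : ℝ)) ∂P) - ∫ u in t..(t + a), ρ u|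
                  ≤ C * lmax / c * Real.exp (-c * (t - s)) := by
  have hamp := PeriodicRenewal.amplitude_pos hmin hmax
  have hc := PeriodicRenewal.rate_pos hmin hmax
  have hL := hmin.trans hmax
  -- Only the total variation estimate needs the full constant; the other two hold with `amplitude`
  -- alone and are weakened at the end.
  refine ⟨1 + 2 * PeriodicRenewal.amplitude lmin lmax, PeriodicRenewal.rate lmin lmax,
    by positivity, hc, fun H hk => ⟨fun t => (PeriodicRenewal.profile lmin H t).toReal,
      hk.isProfile_profile hmin hmax, fun ρ' hρ' => hk.profile_unique hT hmin hmax hρ',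
      hk.isProbabilityMeasure_nuInf hmin hmax, ?_⟩⟩
  intro Ω _ P _ s τ ha t hst
  have hR := ha.isRenewalDensity hk hmin hmax
  refine ⟨ha.ae_bddAbove hk hmin hmax t, ha.aemeasurable_age hk hmin hmax hst,
    ha.tvDist_le hk hmin hmax hst,
    ⟨_, ha.tendsto_real_count_sub_pos hk hmin hmax hst, ?_⟩, fun a ha0 => ?_⟩
  · have hgap := hR.gap_le_ofReal hk hmin hmax hst
    refine (PeriodicRenewal.abs_toReal_sub_le (x := PeriodicRenewal.amplitude lmin lmax * lmax *
      Real.exp (-PeriodicRenewal.rate lmin lmax * (t - s)))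
      (ne_top_of_le_ne_top ENNReal.ofReal_ne_top (hR.le t)) (hk.profile_ne_top hmin hmax t)
      (by positivity) ((PeriodicRenewal.IsRenewalDensity.le_add_gap t).trans (add_le_add_right hgap _))
      ((PeriodicRenewal.IsRenewalDensity.profile_le_add_gap t).trans (add_le_add_right hgap _))).trans ?_
    gcongr
    linarith
  · have hta : t ≤ t + a := by linarith
    obtain ⟨hi, he⟩ := ha.integral_count_sub hk hmin hmax hst hta
    refine ⟨hi, ?_⟩
    rw [he, hk.intervalIntegral_profile hmin hmax hta]
    refine (hR.abs_setLIntegral_sub_le hk hmin hmax hst (t + a)).trans ?_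
    gcongr
    linarith
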